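/- **Setting.** Let $f(\cdot,z):\mathbb R^d\to\mathbb R$ be differentiable for every record $z$ of a dataset $D=(z_1,\dots,z_n)$, $n\ge1$, let $F(w)=\frac1n\sum_i f(w,z_i)$, and let $\mathcal R_F=\sup F-\inf F$ be finite. Assume that $F$ is $\beta$-smooth, $\beta>0$: $|F(w')-F(w)-\langle\nabla F(w),w'-w\rangle|\le\frac\beta2\|w'-w\|^2$ for all $w,w'$; and that, for some $\kappa>1$, a uniformly drawn record $z$ of $D$ satisfies $\Pr(\|\nabla f(w,z)-\nabla F(w)\|\ge t)\le e^{-t/\kappa}$ for all $w$ and $t$. Let $\varepsilon>0$, $0<\delta<1$, $0<q\le1$, and put $\rho=\sqrt{d\log(1/\delta)}/(n\varepsilon)$. **Algorithm (clipped ModelMix with step size $\gamma$).** From $w_0,w_{-1}\in\mathbb R^d$ and thresholds $\tau_k\ge0$, iteration $k=1,\dots,T$ selects each record independently with probability $q$ into $S_k$, forms $G_{k-1}=\sum_{z\in S_k}\nabla f(w_{k-1},z)\min\{1,c/\|\nabla f(w_{k-1},z)\|\}$, draws $\alpha_k$ uniform on $[0,1]^d$ and $\Delta_k$ with law $\nu$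 (everything independent), and sets, coordinatewise, $$w_k(j)=\alpha_k(j)\,\tilde w_{k-1}(j)+(1-\alpha_k(j))\,\tilde w_{k-2}(j)-\gamma\,(G_{k-1}(j)+\Delta_k(j)).$$ Here $\tilde w_{k-1}(j)=w_{k-1}(j)+s\tau_k/2$ and $\tilde w_{k-2}(j)=w_{k-2}(j)-s\tau_k/2$ with $s=\mathrm{sign}(w_{k-1}(j)-w_{k-2}(j))$ if $|w_{k-1}(j)-w_{k-2}(j)|<\tau_k$, and $\tilde w=w$ in that coordinate otherwise. The noise has level $V$ if it is centred, square integrable, and $\mathbb E\|\Delta\|^2\le V c^2dT\log(1/\delta)/\varepsilon^2$. **Theorem.** For every $\kappa>1$ there is $\psi>0$, depending only on $\kappa$, such that the following hold. 1. *(Utility.)* For all $0<q\le1$ and $V\ge0$ there is a constant $v\ge0$, depending only on $\kappa$, $q$, $V$, such that in the setting above, if $$c\ge\max\{4\kappa\log10,\;-\psi\,\kappa\log(\kappa)\log\rho\},$$ then ModelMix with noise of level $V$, $T=\lceil (n\varepsilon)^2/(d\log(1/\delta))\rceil$, $\eta=\dfrac{\sqrt{\mathcal R_F\,d\log(1/\delta)}}{n\varepsilon\,(c/q)\sqrt{\frac{101}{12}\beta}}$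 and step size $\gamma=\eta/(nq)$ satisfies $$\mathbb E\Big[\frac1T\sum_{k=0}^{T-1}\min\{\tfrac9{20}\|\nabla F(w_k)\|^2,\tfrac c{20}\|\nabla F(w_k)\|\}\Big]\le\Big(\frac v2+\frac52\Big)\frac{c\sqrt{\mathcal R_F\frac{101}{12}\beta\,d\log(1/\delta)}}{n\varepsilon}+\frac{28\,c\,\beta\,d\log(1/\delta)\,\tilde{\mathcal W}_0}{12\,q\,(n\varepsilon)^2}$$ $$\qquad+\frac{c\sqrt{d\log(1/\delta)}\sqrt{\frac{101}{12}}\,\beta^{3/2}}{q\,n\varepsilon\sqrt{\mathcal R_F}}\Big(\frac{\sum_{k=1}^Td\tau_k^2}{12}+\frac{21\,\tilde{\mathcal W}_0^2}{24}\Big),\qquad\tilde{\mathcal W}_0=\|w_0-w_{-1}\|$$ (the last term is read as $0$ when $\mathcal R_F=0$). 2. *(Privacy.)* For every $A>0$ there is $V>0$, depending only on $A$, such that for every $f$, $c>0$, $\gamma$, $\tau$, $w_0,w_{-1}$, $T$, $q\in[0,1]$, $0<\delta<1$ and $0<\varepsilon\le A\log(1/\delta)$, the Gaussian noise $\mathcal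 N(0,\sigma^2I_d)$ with $\sigma^2=Vc^2T\log(1/\delta)/\varepsilon^2$ has level $V$, and with it the released trajectory $(w_1,\dots,w_T)$ of ModelMix is $(\varepsilon,\delta)$-differentially private under adding or removing one record. 3. *(Order.)* If $\tau_k\le K\eta$ for all $1\le k\le T$, $\mathcal R_F>0$, $\rho\le1$ and $c\ge4\kappa\log10$, then the right-hand side in 1 is at most $C\,c\,\rho=C\,c\sqrt{d\log(1/\delta)}/(n\varepsilon)$, where $C$ depends only on $d,q,\beta,\mathcal R_F,\tilde{\mathcal W}_0,\kappa,v,K$ (not on $n,\varepsilon,\delta,c$). -/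

import Mathlib

open MeasureTheory ProbabilityTheory Set
open scoped RealInnerProductSpace

universe u

noncomputable section

namespace ModelMix

/-- The parameter space `ℝᵈ` with its Euclidean norm. -/
abbrev Param (d : ℕ) := EuclideanSpace ℝ (Fin d)

/-! ### Objective and assumptions -/

/-- `F(w) = (1/n) ∑ᵢ f(w, zᵢ)` for the dataset `D = (z₁, …, zₙ)`. -/
def risk {Z : Type*} {d n : ℕ} (f : Param d → Z → ℝ) (D : Fin n → Z) (w : Param d) : ℝ :=
  (1 / (n : ℝ)) * ∑ i, f w (D i)

/-- `∇_w f(w, z)`. -/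
def sampleGrad {Z : Type*} {d : ℕ} (f : Param d → Z → ℝ) (w : Param d) (z : Z) : Param d :=
  gradient (fun u => f u z) w

/-- `β`-smoothness: `|F(w') - F(w) - ⟨∇F(w), w' - w⟩| ≤ (β/2) ‖w' - w‖²`. -/
def IsSmooth {d : ℕ} (β : ℝ) (F : Param d → ℝ) : Prop :=
  Differentiable ℝ F ∧
    ∀ w w' : Param d, |F w' - F w - ⟪gradient F w, w' - w⟫| ≤ β / 2 * ‖w' - w‖ ^ 2

/-- Sub-exponential tail of the gradient of a uniformly drawn sample:
`Pr(‖∇f(w, z) - ∇F(w)‖ ≥ t) ≤ exp(-t/κ)` for all `w` and `t`. -/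
def SubExpGrad {Z : Type*} {d n : ℕ} (f : Param d → Z → ℝ) (D : Fin n → Z) (κ : ℝ) : Prop :=
  ∀ (w : Param d) (t : ℝ),
    (Set.ncard {i : Fin n | t ≤ ‖sampleGrad f w (D i) - gradient (risk f D) w‖} : ℝ) / n
      ≤ Real.exp (-t / κ)

/-- `𝓡_F = sup F - inf F` (used for bounded `F` only). -/
def riskGap {d : ℕ} (F : Param d → ℝ) : ℝ := (⨆ w, F w) - ⨅ w, F w

/-! ### The algorithm -/

/-- `CP(g, c) = g · min{1, c/‖g‖}`. -/
def clip {d : ℕ} (c : ℝ) (g : Param d) : Param d := min 1 (c / ‖g‖) • g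

/-- Randomness of one iteration: the Poisson-sampling mask, the mixing weights
`α ∈ [0,1]ᵈ`, and the additive noise `Δ`. -/
abbrev Seed (d n : ℕ) := (Fin n → Bool) × (Fin d → ℝ) × Param d

/-- The law of `Seed`: independent Bernoulli(`q`) selections of the samples, independent
uniform weights, and an independent noise vector with law `ν`. -/
def seedLaw {d : ℕ} (n : ℕ) (q : unitInterval) (ν : Measure (Param d)) : Measure (Seed d n) :=
  (Measure.pi fun _ : Fin n => bernoulliMeasure true false q).prod
    ((Measure.pi fun _ : Fin d => (volume : Measure ℝ).restrict (Icc 0 1)).prod ν)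

instance {d n : ℕ} (q : unitInterval) (ν : Measure (Param d)) [IsProbabilityMeasure ν] :
    IsProbabilityMeasure (seedLaw n q ν) := by
  have : IsProbabilityMeasure ((volume : Measure ℝ).restrict (Icc 0 1)) := ⟨by simp⟩
  unfold seedLaw
  infer_instance

/-- Fresh independent randomness in every iteration. -/
def runLaw {d : ℕ} (n : ℕ) (q : unitInterval) (ν : Measure (Param d)) [IsProbabilityMeasure ν] :
    Measure (ℕ → Seed d n) :=
  Measure.infinitePi fun _ => seedLaw n q ν

/-- `G = ∑_{z ∈ S} CP(∇f(w, z), c)` for the minibatch `S` selected by `mask`. -/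
def batchGrad {Z : Type*} {d n : ℕ} (f : Param d → Z → ℝ) (D : Fin n → Z) (c : ℝ)
    (mask : Fin n → Bool) (w : Param d) : Param d :=
  ∑ i, if mask i then clip c (sampleGrad f w (D i)) else 0

/-- The coordinates by which two states closer than `t` are pushed apart: `+` for the newer
state `a` and `-` for the older state `b`. -/
def spread {d : ℕ} (t : ℝ) (a b : Param d) (j : Fin d) : ℝ :=
  if |a j - b j| < t then Real.sign (a j - b j) * t / 2 else 0

/-- One update from the last two states `a = w_{k-1}`, `b = w_{k-2}` with step size `γ`: mix the
two (spread) states coordinatewise with weights `α`, then subtract `γ (G(a) + Δ)`. -/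
def step {Z : Type*} {d n : ℕ} (f : Param d → Z → ℝ) (D : Fin n → Z) (c γ t : ℝ)
    (s : Seed d n) (a b : Param d) : Param d :=
  WithLp.toLp 2 fun j =>
    s.2.1 j * (a j + spread t a b j) + (1 - s.2.1 j) * (b j - spread t a b j)
      - γ * (batchGrad f D c s.1 a j + s.2.2 j)

/-- The pair `(w_k, w_{k-1})` after `k` iterations from `(w_0, w_{-1}) = (w₀, wm)`; iteration `k`
uses the mixing threshold `τ k` (`k = 1, 2, …`). -/
def states {Z : Type*} {d n : ℕ} (f : Param d → Z → ℝ) (D : Fin n → Z) (c γ : ℝ) (τ : ℕ → ℝ)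
    (w₀ wm : Param d) (ω : ℕ → Seed d n) : ℕ → Param d × Param d
  | 0 => (w₀, wm)
  | k + 1 =>
    let p := states f D c γ τ w₀ wm ω k
    (step f D c γ (τ (k + 1)) (ω k) p.1 p.2, p.1)

/-- The iterate `w_k`. -/
def iter {Z : Type*} {d n : ℕ} (f : Param d → Z → ℝ) (D : Fin n → Z) (c γ : ℝ) (τ : ℕ → ℝ)
    (w₀ wm : Param d) (ω : ℕ → Seed d n) (k : ℕ) : Param d :=
  (states f D c γ τ w₀ wm ω k).1

/-- The law of the whole released trajectory `(w_1, …, w_T)`. -/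
def trajLaw {Z : Type*} {d n : ℕ} (f : Param d → Z → ℝ) (D : Fin n → Z) (c γ : ℝ) (τ : ℕ → ℝ)
    (w₀ wm : Param d) (q : unitInterval) (ν : Measure (Param d)) [IsProbabilityMeasure ν] (T : ℕ) :
    Measure (Fin T → Param d) :=
  (runLaw n q ν).map fun ω k => iter f D c γ τ w₀ wm ω (k + 1)

/-! The trajectory is measurable, so that its law is a probability measure. -/

lemma measurable_sampleGrad {Z : Type*} {d : ℕ} (f : Param d → Z → ℝ) (z : Z) :
    Measurable fun w => sampleGrad f w z := by
  unfold sampleGrad gradient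
  exact (InnerProductSpace.toDual ℝ (Param d)).symm.continuous.measurable.comp
    (measurable_fderiv ℝ _)

lemma measurable_sign : Measurable Real.sign := by
  unfold Real.sign
  exact Measurable.ite measurableSet_Iio measurable_const
    (Measurable.ite measurableSet_Ioi measurable_const measurable_const)

lemma measurable_states {Z : Type*} {d n : ℕ} (f : Param d → Z → ℝ) (D : Fin n → Z) (c γ : ℝ)
    (τ : ℕ → ℝ) (w₀ wm : Param d) (k : ℕ) :
    Measurable fun ω : ℕ → Seed d n => states f D c γ τ w₀ wm ω k := by
  have hco : ∀ j : Fin d, Measurable fun w : Param d => w j := fun j => by fun_prop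
  induction k with
  | zero => exact measurable_const
  | succ k ih =>
    refine Measurable.prodMk ?_ ih.fst
    have hs : Measurable fun ω : ℕ → Seed d n => ω k := measurable_pi_apply k
    have ha := ih.fst
    have hb := ih.snd
    refine (WithLp.measurable_toLp 2 _).comp (measurable_pi_lambda _ fun j => ?_)
    have hspread : Measurable fun ω : ℕ → Seed d n =>
        spread (τ (k + 1)) (states f D c γ τ w₀ wm ω k).1 (states f D c γ τ w₀ wm ω k).2 j := by
      have hd := ((hco j).comp ha).sub ((hco j).comp hb)
      refine Measurable.ite (measurableSet_lt hd.abs measurable_const) ?_ measurable_const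
      exact ((measurable_sign.comp hd).mul_const _).div_const _
    have hG : Measurable fun ω : ℕ → Seed d n =>
        batchGrad f D c (ω k).1 (states f D c γ τ w₀ wm ω k).1 := by
      refine Finset.measurable_sum _ fun i _ => ?_
      refine Measurable.ite ?_ ?_ measurable_const
      · exact ((measurable_pi_apply i).comp hs.fst) (measurableSet_singleton true)
      · have hg := (measurable_sampleGrad f (D i)).comp ha
        exact (measurable_const.min (measurable_const.div hg.norm)).smul hg
    have hα : Measurable fun ω : ℕ → Seed d n => (ω k).2.1 j :=
      (measurable_pi_apply j).comp hs.snd.fst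
    have hΔ : Measurable fun ω : ℕ → Seed d n => (ω k).2.2 j := (hco j).comp hs.snd.snd
    exact ((hα.mul (((hco j).comp ha).add hspread)).add
      ((measurable_const.sub hα).mul (((hco j).comp hb).sub hspread))).sub
        ((((hco j).comp hG).add hΔ).const_mul γ)

instance {Z : Type*} {d n : ℕ} (f : Param d → Z → ℝ) (D : Fin n → Z) (c γ : ℝ) (τ : ℕ → ℝ)
    (w₀ wm : Param d) (q : unitInterval) (ν : Measure (Param d)) [IsProbabilityMeasure ν] (T : ℕ) :
    IsProbabilityMeasure (trajLaw f D c γ τ w₀ wm q ν T) := by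
  unfold trajLaw runLaw
  exact Measure.isProbabilityMeasure_map
    (measurable_pi_lambda _ fun k => (measurable_states f D c γ τ w₀ wm _).fst).aemeasurable

/-! ### Privacy and noise -/

/-- `(ε, δ)`-differential privacy under adding or removing one record, for a mechanism that maps a
dataset of any size to a law on the output space. -/
def IsDP {Z O : Type*} [MeasurableSpace O] (ε δ : ℝ)
    (M : (n : ℕ) → (Fin n → Z) → Measure O) : Prop :=
  ∀ (n : ℕ) (D : Fin n → Z) (i : Fin (n + 1)) (z : Z) (S : Set O), MeasurableSet S →
    M n D S ≤ ENNReal.ofReal (Real.exp ε) * M (n + 1) (i.insertNth z D) S + ENNReal.ofReal δ ∧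
    M (n + 1) (i.insertNth z D) S ≤ ENNReal.ofReal (Real.exp ε) * M n D S + ENNReal.ofReal δ

/-- The noise law `ν` is centred, square integrable, and `E‖Δ‖² ≤ V · c² d T log(1/δ) / ε²`. -/
def NoiseLevel {d : ℕ} (ν : Measure (Param d)) (V c ε δ : ℝ) (T : ℕ) : Prop :=
  MemLp id 2 ν ∧ ∫ x, x ∂ν = 0 ∧
    ∫ x, ‖x‖ ^ 2 ∂ν ≤ V * (c ^ 2 * d * T * Real.log (1 / δ) / ε ^ 2)

/-- The isotropic Gaussian `N(0, σ² I_d)` with `σ² = V · c² T log(1/δ) / ε²`. -/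
def gaussNoise (d : ℕ) (V c ε δ : ℝ) (T : ℕ) : Measure (Param d) :=
  (stdGaussian (Param d)).map fun x => √(V * (c ^ 2 * T * Real.log (1 / δ) / ε ^ 2)) • x

instance (d : ℕ) (V c ε δ : ℝ) (T : ℕ) : IsProbabilityMeasure (gaussNoise d V c ε δ T) :=
  Measure.isProbabilityMeasure_map (Measurable.aemeasurable (by fun_prop))

/-! ### Parameters and the bound -/

/-- `√(d log(1/δ)) / (n ε)`. -/
def privRate (d n : ℕ) (ε δ : ℝ) : ℝ := √(d * Real.log (1 / δ)) / (n * ε)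

/-- The number of iterations `T = ⌈(nε)² / (d log(1/δ))⌉`. -/
def numIter (d n : ℕ) (ε δ : ℝ) : ℕ := ⌈(n * ε) ^ 2 / (d * Real.log (1 / δ))⌉₊

/-- The normalised step size
`η = √(𝓡 d log(1/δ)) / (n ε (c/q) √((101/12) β))`; the algorithm is run with `η / (n q)`. -/
def stepSize (d n : ℕ) (q β R c ε δ : ℝ) : ℝ :=
  √(R * (d * Real.log (1 / δ))) / (n * ε * (c / q) * √(101 / 12 * β))

/-- The right-hand side of the utility bound. -/
def utilityBound (d n : ℕ) (q β R W v c ε δ : ℝ) (τ : ℕ → ℝ) (T : ℕ) : ℝ :=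
  (v / 2 + 5 / 2) * (c * √(R * (101 / 12) * β * d * Real.log (1 / δ)) / (n * ε))
    + 28 * c * β * (d * Real.log (1 / δ)) * W / (12 * q * (n * ε) ^ 2)
    + c * √(d * Real.log (1 / δ)) * √(101 / 12) * (β * √β) / (q * (n * ε) * √R)
      * ((∑ k ∈ Finset.Icc 1 T, d * τ k ^ 2) / 12 + 21 * W ^ 2 / 24)

end ModelMix

end

open ModelMix

/-! Privacy. Two output laws are compared through `HolderDominated`, a Rényi divergence bound of
order `l` written in dual form, so that no density of the trajectory law is ever needed. In this
form the bound passes to images and to mixtures over shared randomness, and constants multiply under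
adaptive composition (`HolderDominated.chain`). Adding or removing a record shifts the noise of one
iteration by a vector of norm at most `c`; for Gaussian noise of variance `σ²` this costs a factor
`exp((l - 1) c² / (2σ²))`. The `T`-th power of this factor is turned into `(ε, δ)` by Young's
inequality. The sampling mask counts as shared randomness, so no amplification by sampling is used
and the noise level does not involve `q`.

Utility. Up to a centred mixing displacement, the next state is the midpoint of the last two states
minus a noisy gradient step. The point `u = (2 w_k + w_{k-1}) / 3` is invariant under midpoint
averaging, so it moves only by the mixing displacement and the gradient step. The displacement has
second moment `‖gap‖² / 12`, and the gap is comparable to `‖w_k - w_{k-1}‖`, which midpoint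
averaging contracts. Hence `F(u) + (β/9) ‖w_k - w_{k-1}‖²` is a Lyapunov function
(`potential_le_of_displacement`, `integral_potential_step_le`). The gradient at `u` is replaced by
the one at `w_k` at a cost absorbed by the contraction.

Clipping keeps a descent direction (`le_inner_meanClip`). If `‖∇F‖ ≤ c/2`, the sub-exponential tail
makes the clipping bias at most `2κ exp(-c/(2κ))`, which the second lower bound on `c` turns into
`2κρ`. If `‖∇F‖ > c/2`, nine tenths of the records have gradients within `c/4` of `∇F`, and these
outweigh the rest.

Telescoping the drift (`integrable_chain_and_sum_le`) and dividing by `ηT`, with `1 ≤ Tρ² ≤ 2` when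
`ρ < 1`, gives the rate. For `ρ ≥ 1` the uniform bound on `∇F` already suffices. The order statement
follows since `τ_k²` is of order `ρ²` and there are about `1/ρ²` terms. -/

noncomputable section

open scoped ENNReal

namespace ModelMix

/-! ### Hölder domination: the dual form of a Rényi divergence bound -/

/-- `∫ g dP ≤ C (∫ gᵖ dQ)^{1/p}` for all measurable `g ≥ 0`; equivalently the density of `P` with
respect to `Q` has `Lˡ(Q)`-norm at most `C`, where `l` is the exponent conjugate to `p`. -/
def HolderDominated {X : Type*} [MeasurableSpace X] (p : ℝ) (C : ℝ≥0∞) (P Q : Measure X) : Prop :=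
  ∀ g : X → ℝ≥0∞, Measurable g → ∫⁻ x, g x ∂P ≤ C * (∫⁻ x, g x ^ p ∂Q) ^ (1 / p)

section Holder

variable {X Y : Type*} [MeasurableSpace X] [MeasurableSpace Y] {p l : ℝ}

/-- Concavity of `x ↦ x^(1/p)`, in the form of Hölder against the constant `1`: a domination that
holds conditionally on shared randomness survives averaging with the same constant. -/
lemma lintegral_le_mul_lintegral_rpow (hpl : p.HolderConjugate l) (μ : Measure X)
    [IsProbabilityMeasure μ] {C : ℝ≥0∞} {F G : X → ℝ≥0∞} (hG : Measurable G)
    (h : ∀ x, F x ≤ C * G x ^ (1 / p)) :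
    ∫⁻ x, F x ∂μ ≤ C * (∫⁻ x, G x ∂μ) ^ (1 / p) := by
  have hp0 : p ≠ 0 := hpl.ne_zero
  have hm : Measurable fun x => G x ^ (1 / p) := hG.pow_const _
  calc ∫⁻ x, F x ∂μ ≤ ∫⁻ x, C * G x ^ (1 / p) ∂μ := lintegral_mono h
    _ = C * ∫⁻ x, G x ^ (1 / p) ∂μ := lintegral_const_mul _ hm
    _ ≤ C * (∫⁻ x, G x ∂μ) ^ (1 / p) := by
      gcongr
      have := ENNReal.lintegral_mul_le_Lp_mul_Lq μ hpl hm.aemeasurable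
        (measurable_const (a := (1 : ℝ≥0∞))).aemeasurable
      simpa [← ENNReal.rpow_mul, hp0] using this

lemma HolderDominated.map {C : ℝ≥0∞} {P Q : Measure X} (h : HolderDominated p C P Q)
    {φ : X → Y} (hφ : Measurable φ) : HolderDominated p C (P.map φ) (Q.map φ) := by
  intro g hg
  rw [lintegral_map hg hφ, lintegral_map (hg.pow_const _) hφ]
  exact h _ (hg.comp hφ)

lemma HolderDominated.prod (hp : p ≠ 0) {C₁ C₂ : ℝ≥0∞} {P₁ Q₁ : Measure X} {P₂ Q₂ : Measure Y}
    [SFinite P₂] [SFinite Q₂]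
    (h₁ : HolderDominated p C₁ P₁ Q₁) (h₂ : HolderDominated p C₂ P₂ Q₂) :
    HolderDominated p (C₁ * C₂) (P₁.prod P₂) (Q₁.prod Q₂) := by
  intro g hg
  have hgp : Measurable fun z => g z ^ p := hg.pow_const _
  have hm : Measurable fun x => ∫⁻ y, g (x, y) ^ p ∂Q₂ := hgp.lintegral_prod_right'
  rw [lintegral_prod _ hg.aemeasurable, lintegral_prod _ hgp.aemeasurable]
  calc ∫⁻ x, ∫⁻ y, g (x, y) ∂P₂ ∂P₁
      ≤ ∫⁻ x, C₂ * (∫⁻ y, g (x, y) ^ p ∂Q₂) ^ (1 / p) ∂P₁ :=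
        lintegral_mono fun x => h₂ _ (hg.comp measurable_prodMk_left)
    _ = C₂ * ∫⁻ x, (∫⁻ y, g (x, y) ^ p ∂Q₂) ^ (1 / p) ∂P₁ :=
        lintegral_const_mul _ (hm.pow_const _)
    _ ≤ C₂ * (C₁ * (∫⁻ x, ((∫⁻ y, g (x, y) ^ p ∂Q₂) ^ (1 / p)) ^ p ∂Q₁) ^ (1 / p)) := by
        gcongr; exact h₁ _ (hm.pow_const _)
    _ = _ := by
        simp only [← ENNReal.rpow_mul, one_div, inv_mul_cancel₀ hp, ENNReal.rpow_one]
        ring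

lemma HolderDominated.pi (hp : p ≠ 0) : ∀ {d : ℕ} {C : Fin d → ℝ≥0∞} {P Q : Fin d → Measure ℝ}
    [∀ i, IsProbabilityMeasure (P i)] [∀ i, IsProbabilityMeasure (Q i)],
    (∀ i, HolderDominated p (C i) (P i) (Q i)) →
    HolderDominated p (∏ i, C i) (Measure.pi P) (Measure.pi Q) := by
  intro d
  induction d with
  | zero =>
    intro C P Q _ _ _ g hg
    rw [Measure.pi_of_empty P, Measure.pi_of_empty Q]
    rw [lintegral_dirac' _ hg, lintegral_dirac' _ (hg.pow_const _)]
    simp [← ENNReal.rpow_mul, hp]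
  | succ d ih =>
    intro C P Q _ _ h
    have hP := ((measurePreserving_piFinSuccAbove P 0).symm).map_eq
    have hQ := ((measurePreserving_piFinSuccAbove Q 0).symm).map_eq
    rw [← hP, ← hQ, Fin.prod_univ_succ]
    exact ((h 0).prod hp (ih fun i => h i.succ)).map (MeasurableEquiv.measurable _)

/-- Hölder applied to the likelihood ratio `exp(hx - h²/2)`, whose `Lˡ` norm is read off the
Gaussian moment generating function: `(l²h²/2 - lh²/2) / l = (l - 1)h²/2`. -/
lemma holderDominated_gaussianReal (hpl : p.HolderConjugate l) (h : ℝ) :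
    HolderDominated p (ENNReal.ofReal (Real.exp ((l - 1) / 2 * h ^ 2)))
      (gaussianReal h 1) (gaussianReal 0 1) := by
  intro g hg
  have hl0 : 0 < l := hpl.symm.pos
  set L : ℝ → ℝ≥0∞ := fun x => ENNReal.ofReal (Real.exp (h * x - h ^ 2 / 2)) with hL
  have hLm : Measurable L := by fun_prop
  have e1 : ∫⁻ x, g x ∂(gaussianReal h 1) = ∫⁻ x, (L * g) x ∂(gaussianReal 0 1) := by
    rw [gaussianReal_of_var_ne_zero _ one_ne_zero, gaussianReal_of_var_ne_zero _ one_ne_zero,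
      lintegral_withDensity_eq_lintegral_mul _ (measurable_gaussianPDF _ _) hg,
      lintegral_withDensity_eq_lintegral_mul _ (measurable_gaussianPDF _ _) (hLm.mul hg)]
    refine lintegral_congr fun x => ?_
    simp only [Pi.mul_apply, hL, gaussianPDF, ← mul_assoc]
    congr 1
    rw [← ENNReal.ofReal_mul (gaussianPDFReal_nonneg _ _ _)]
    simp only [gaussianPDFReal, mul_assoc, ← Real.exp_add]
    congr 3
    simp
    ring
  have e2 : (∫⁻ x, L x ^ l ∂(gaussianReal 0 1)) ^ (1 / l)
      = ENNReal.ofReal (Real.exp ((l - 1) / 2 * h ^ 2)) := by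
    have e3 : ∀ x, L x ^ l
        = ENNReal.ofReal (Real.exp (-(l * h ^ 2 / 2)) * Real.exp ((l * h) * x)) := by
      intro x
      rw [hL, ENNReal.ofReal_rpow_of_pos (Real.exp_pos _), ← Real.exp_mul, ← Real.exp_add]
      congr 2; ring
    simp_rw [e3]
    rw [← ofReal_integral_eq_lintegral_ofReal
      ((integrable_exp_mul_gaussianReal _).const_mul _)
      (Filter.Eventually.of_forall fun x => by positivity), integral_const_mul]
    have := mgf_gaussianReal (p := gaussianReal 0 1) (X := id) (by simp) (l * h) (μ := 0) (v := 1)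
    simp only [mgf, id] at this
    rw [this, ← Real.exp_add, ENNReal.ofReal_rpow_of_pos (Real.exp_pos _), ← Real.exp_mul]
    congr 2
    simp
    field_simp
    ring
  rw [e1, ← e2]
  exact ENNReal.lintegral_mul_le_Lp_mul_Lq _ hpl.symm hLm.aemeasurable hg.aemeasurable

lemma holderDominated_stdGaussian (hpl : p.HolderConjugate l) {d : ℕ} (h : Param d) :
    HolderDominated p (ENNReal.ofReal (Real.exp ((l - 1) / 2 * ‖h‖ ^ 2)))
      ((stdGaussian (Param d)).map fun x => x + h) (stdGaussian (Param d)) := by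
  have key := (HolderDominated.pi hpl.ne_zero
    (fun i => holderDominated_gaussianReal hpl (h i))).map (WithLp.measurable_toLp 2 (Fin d → ℝ))
  have eC : ∏ i, ENNReal.ofReal (Real.exp ((l - 1) / 2 * h i ^ 2))
      = ENNReal.ofReal (Real.exp ((l - 1) / 2 * ‖h‖ ^ 2)) := by
    rw [← ENNReal.ofReal_prod_of_nonneg (fun i _ => (Real.exp_pos _).le), ← Real.exp_sum,
      ← Finset.mul_sum, EuclideanSpace.real_norm_sq_eq]
  have eS : (stdGaussian (Param d)).map (fun x => x + h)
      = (Measure.pi fun i => gaussianReal (h i) 1).map (WithLp.toLp 2) := by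
    have : (Measure.pi fun i => gaussianReal (h i) 1)
        = (Measure.pi fun _ : Fin d => gaussianReal 0 1).map fun x i => x i + h i := by
      rw [Measure.pi_map_pi (f := fun i x => x + h i) (fun i => by fun_prop)]
      simp [gaussianReal_map_add_const]
    rw [this, ← map_pi_eq_stdGaussian, Measure.map_map (by fun_prop) (by fun_prop),
      Measure.map_map (by fun_prop) (by fun_prop)]
    rfl
  rw [eC, map_pi_eq_stdGaussian] at key
  rwa [eS]

/-- The conversion of a Rényi bound to approximate differential privacy. -/
lemma HolderDominated.measure_le (hpl : p.HolderConjugate l) {b ε δ : ℝ} {P Q : Measure X}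
    (h : HolderDominated p (ENNReal.ofReal (Real.exp b)) P Q)
    (hb : l * b - ε * (l - 1) ≤ Real.log δ) (hδ : 0 < δ) {S : Set X} (hS : MeasurableSet S) :
    P S ≤ ENNReal.ofReal (Real.exp ε) * Q S + ENNReal.ofReal δ := by
  have hp0 := hpl.pos
  have hl0 := hpl.symm.pos
  have h1 := h (S.indicator 1) (measurable_one.indicator hS)
  have h2 : ∀ x, (S.indicator (1 : X → ℝ≥0∞) x) ^ p = S.indicator 1 x := by
    intro x; by_cases hx : x ∈ S <;> simp [hx, hp0]
  simp_rw [h2] at h1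
  rw [lintegral_indicator_one hS, lintegral_indicator_one hS] at h1
  -- The factor `e^(ε/p)` is moved from the constant to `Q S` before Young's inequality, so that one
  -- term becomes `e^ε Q S` and the other `exp(lb - ε(l - 1))`; the factors `1/p` and `1/l` are then
  -- discarded.
  have hy := ENNReal.young_inequality
    ((ENNReal.ofReal (Real.exp ε) * Q S) ^ (1 / p)) (ENNReal.ofReal (Real.exp (b - ε / p))) hpl
  have e1 : (ENNReal.ofReal (Real.exp ε) * Q S) ^ (1 / p) * ENNReal.ofReal (Real.exp (b - ε / p))
      = ENNReal.ofReal (Real.exp b) * Q S ^ (1 / p) := by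
    rw [ENNReal.mul_rpow_of_nonneg _ _ (by positivity),
      ENNReal.ofReal_rpow_of_pos (Real.exp_pos _), ← Real.exp_mul, mul_right_comm,
      ← ENNReal.ofReal_mul (Real.exp_pos _).le, ← Real.exp_add]
    congr 3; ring
  have hp1 : (1 : ℝ≥0∞) ≤ ENNReal.ofReal p := by simpa using hpl.lt.le
  have hl1 : (1 : ℝ≥0∞) ≤ ENNReal.ofReal l := by simpa using hpl.symm.lt.le
  rw [e1] at hy
  refine h1.trans (hy.trans (add_le_add ?_ ?_))
  · rw [← ENNReal.rpow_mul, one_div, inv_mul_cancel₀ hp0.ne', ENNReal.rpow_one]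
    exact ENNReal.div_le_of_le_mul' (le_mul_of_one_le_left' hp1)
  · refine (ENNReal.div_le_of_le_mul' (le_mul_of_one_le_left' hl1)).trans ?_
    rw [ENNReal.ofReal_rpow_of_pos (Real.exp_pos _), ← Real.exp_mul]
    refine ENNReal.ofReal_le_ofReal ?_
    rw [← Real.exp_log hδ]
    refine Real.exp_le_exp.2 (le_trans (le_of_eq ?_) hb)
    have : l / p = l - 1 := by
      have := hpl.symm.sub_one_mul_conj
      field_simp; linarith
    rw [← this]; ring

end Holder

/-! ### Markov chains driven by fresh randomness -/

/-- Resampling one coordinate leaves the product law unchanged. As the chain up to time `k` does not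
read coordinate `k`, this serves as the Markov property without conditional expectations. -/
lemma measurePreserving_update_infinitePi {S : Type*} [MeasurableSpace S] (μ : Measure S)
    [IsProbabilityMeasure μ] (k : ℕ) :
    MeasurePreserving (fun z : (ℕ → S) × S => Function.update z.1 k z.2)
      ((Measure.infinitePi fun _ => μ).prod μ) (Measure.infinitePi fun _ => μ) := by
  have hm : Measurable fun z : (ℕ → S) × S => Function.update z.1 k z.2 := by
    refine measurable_pi_lambda _ fun j => ?_
    by_cases h : j = k
    · subst h; simpa using measurable_snd
    · simpa [Function.update_of_ne h] using (by fun_prop : Measurable fun c : (ℕ → S) × S => c.1 j)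
  refine ⟨hm, Measure.eq_infinitePi _ fun s t ht => ?_⟩
  rw [Measure.map_apply hm (MeasurableSet.pi s.countable_toSet fun i _ => ht i)]
  by_cases hk : k ∈ s
  · have : (fun z : (ℕ → S) × S => Function.update z.1 k z.2) ⁻¹' ((s : Set ℕ).pi t)
        = (((s.erase k : Finset ℕ) : Set ℕ).pi t) ×ˢ t k := by
      ext z
      simp only [mem_preimage, Set.mem_pi, Finset.mem_coe, mem_prod, Finset.mem_erase]
      constructor
      · intro h
        exact ⟨fun i hi => by simpa [hi.1] using h i hi.2, by simpa using h k hk⟩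
      · rintro ⟨h1, h2⟩ i hi
        by_cases e : i = k
        · subst e; simpa using h2
        · simpa [e] using h1 i ⟨e, hi⟩
    rw [this, Measure.prod_prod, Measure.infinitePi_pi _ fun i _ => ht i, mul_comm,
      Finset.mul_prod_erase s (fun i => μ (t i)) hk]
  · have : (fun z : (ℕ → S) × S => Function.update z.1 k z.2) ⁻¹' ((s : Set ℕ).pi t)
        = ((s : Set ℕ).pi t) ×ˢ univ := by
      ext z
      simp only [mem_preimage, Set.mem_pi, Finset.mem_coe, mem_prod, mem_univ, and_true]
      refine forall₂_congr fun i hi => ?_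
      rw [Function.update_of_ne (by rintro rfl; exact hk hi)]
    rw [this, Measure.prod_prod, Measure.infinitePi_pi _ fun i _ => ht i]
    simp

section Chain

/-- The state after `k` steps of the recursion `xₖ₊₁ = Ψₖ(xₖ, ωₖ)`. -/
def chain {E S : Type*} (Ψ : ℕ → E → S → E) (x : E) (ω : ℕ → S) : ℕ → E
  | 0 => x
  | k + 1 => Ψ k (chain Ψ x ω k) (ω k)


lemma chain_update {E S : Type*} (Ψ : ℕ → E → S → E) (x : E) (ω : ℕ → S) (s : S) {j k : ℕ} (h : j ≤ k) :
    chain Ψ x (Function.update ω k s) j = chain Ψ x ω j := by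
  induction j with
  | zero => rfl
  | succ j ih =>
    simp only [chain]
    rw [ih (by omega), Function.update_of_ne (by omega)]

variable {E S S' : Type*} [MeasurableSpace E] [MeasurableSpace S] [MeasurableSpace S']

lemma measurable_chain {Ψ : ℕ → E → S → E} (hΨ : ∀ k, Measurable fun z : E × S => Ψ k z.1 z.2)
    (x : E) (k : ℕ) : Measurable fun ω : ℕ → S => chain Ψ x ω k := by
  induction k with
  | zero => exact measurable_const
  | succ k ih => exact (hΨ k).comp (ih.prodMk (measurable_pi_apply k))

lemma lintegral_chain_succ {Ψ : ℕ → E → S → E} (hΨ : ∀ k, Measurable fun z : E × S => Ψ k z.1 z.2)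
    (x : E) (μ : Measure S) [IsProbabilityMeasure μ] (k : ℕ) {g : E → ℝ≥0∞} (hg : Measurable g) :
    ∫⁻ ω, g (chain Ψ x ω (k + 1)) ∂(Measure.infinitePi fun _ => μ)
      = ∫⁻ ω, ∫⁻ s, g (Ψ k (chain Ψ x ω k) s) ∂μ ∂(Measure.infinitePi fun _ => μ) := by
  have hm : Measurable fun ω : ℕ → S => g (chain Ψ x ω (k + 1)) :=
    hg.comp (measurable_chain hΨ x _)
  rw [← (measurePreserving_update_infinitePi μ k).lintegral_comp hm]
  rw [lintegral_prod _ (by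
    exact (hm.comp (measurePreserving_update_infinitePi μ k).measurable).aemeasurable)]
  simp [chain, chain_update]

/-- Adaptive composition. -/
lemma HolderDominated.chain {p : ℝ} (hp : p ≠ 0) {C : ℝ≥0∞}
    {Ψ : ℕ → E → S → E} (hΨ : ∀ k, Measurable fun z : E × S => Ψ k z.1 z.2)
    {Ψ' : ℕ → E → S' → E} (hΨ' : ∀ k, Measurable fun z : E × S' => Ψ' k z.1 z.2)
    (μ : Measure S) [IsProbabilityMeasure μ] (μ' : Measure S') [IsProbabilityMeasure μ'] (x : E)
    (T : ℕ) (h : ∀ k < T, ∀ y, HolderDominated p C (μ'.map (Ψ' k y)) (μ.map (Ψ k y))) :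
    HolderDominated p (C ^ T)
      ((Measure.infinitePi fun _ => μ').map fun ω => ModelMix.chain Ψ' x ω T)
      ((Measure.infinitePi fun _ => μ).map fun ω => ModelMix.chain Ψ x ω T) := by
  induction T with
  | zero =>
    intro g hg
    rw [lintegral_map hg (measurable_chain hΨ' x 0),
      lintegral_map (hg.pow_const p) (measurable_chain hΨ x 0)]
    simp [ModelMix.chain, ← ENNReal.rpow_mul, hp]
  | succ T ih =>
    intro g hg
    have hgp : Measurable fun z => g z ^ p := hg.pow_const p
    have hy : ∀ k y, Measurable (Ψ k y) := fun k y => (hΨ k).comp measurable_prodMk_left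
    have hy' : ∀ k y, Measurable (Ψ' k y) := fun k y => (hΨ' k).comp measurable_prodMk_left
    set G : E → ℝ≥0∞ := fun y => ∫⁻ s, g (Ψ T y s) ^ p ∂μ with hG
    have hGm : Measurable G := (hgp.comp (hΨ T)).lintegral_prod_right'
    rw [lintegral_map hg (measurable_chain hΨ' x _), lintegral_map hgp (measurable_chain hΨ x _),
      lintegral_chain_succ hΨ' x μ' T hg, lintegral_chain_succ hΨ x μ T hgp]
    have step : ∀ y, ∫⁻ s, g (Ψ' T y s) ∂μ' ≤ C * G y ^ (1 / p) := by
      intro y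
      have := h T (by omega) y g hg
      rwa [lintegral_map hg (hy' T y), lintegral_map hgp (hy T y)] at this
    -- The test function `G ^ (1 / p)` has `p`-th power `G`, so the exponents cancel and the new
    -- step contributes only a factor `C`.
    have ihg := ih (fun k hk => h k (by omega)) (fun y => G y ^ (1 / p)) (hGm.pow_const _)
    rw [lintegral_map (hGm.pow_const _) (measurable_chain hΨ' x _),
      lintegral_map ((hGm.pow_const _).pow_const _) (measurable_chain hΨ x _)] at ihg
    simp only [← ENNReal.rpow_mul, one_div, inv_mul_cancel₀ hp, ENNReal.rpow_one] at ihg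
    calc _ ≤ ∫⁻ ω, C * G (ModelMix.chain Ψ' x ω T) ^ (1 / p) ∂(Measure.infinitePi fun _ => μ') :=
          lintegral_mono fun ω => step _
      _ = C * ∫⁻ ω, G (ModelMix.chain Ψ' x ω T) ^ (1 / p) ∂(Measure.infinitePi fun _ => μ') :=
          lintegral_const_mul _ ((hGm.comp (measurable_chain hΨ' x _)).pow_const _)
      _ ≤ _ := by
          simp only [one_div]
          rw [pow_succ', mul_assoc]
          gcongr

end Chain

/-! ### Privacy -/

lemma norm_clip_le {d : ℕ} {c : ℝ} (hc : 0 ≤ c) (g : Param d) : ‖clip c g‖ ≤ c := by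
  have h0 : 0 ≤ min 1 (c / ‖g‖) := le_min zero_le_one (by positivity)
  rw [clip, norm_smul, Real.norm_of_nonneg h0]
  rcases eq_or_ne ‖g‖ 0 with h | h
  · simp [h, hc]
  · calc min 1 (c / ‖g‖) * ‖g‖ ≤ c / ‖g‖ * ‖g‖ := by gcongr; exact min_le_right _ _
      _ = c := div_mul_cancel₀ _ h

/-! ### Measurability of the update -/

section Measurability

variable {Z : Type*} {d n : ℕ} (f : Param d → Z → ℝ) (D : Fin n → Z) (c γ t : ℝ)

lemma measurable_clip : Measurable (clip c : Param d → Param d) := by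
  unfold clip
  fun_prop

lemma measurable_batchGrad :
    Measurable fun z : (Fin n → Bool) × Param d => batchGrad f D c z.1 z.2 := by
  refine Finset.measurable_sum _ fun i _ => Measurable.ite ?_ ?_ measurable_const
  · have h : Measurable fun z : (Fin n → Bool) × Param d => z.1 i := by fun_prop
    exact h (measurableSet_singleton true)
  · exact (measurable_clip c).comp ((measurable_sampleGrad f (D i)).comp measurable_snd)

lemma measurable_spread (j : Fin d) :
    Measurable fun z : Param d × Param d => spread t z.1 z.2 j := by
  have hd : Measurable fun z : Param d × Param d => z.1 j - z.2 j := by fun_prop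
  refine Measurable.ite (measurableSet_lt hd.abs measurable_const) ?_ measurable_const
  exact ((measurable_sign.comp hd).mul_const _).div_const _

lemma measurable_step :
    Measurable fun z : (Param d × Param d) × Seed d n => step f D c γ t z.2 z.1.1 z.1.2 := by
  refine (WithLp.measurable_toLp 2 _).comp (measurable_pi_lambda _ fun j => ?_)
  have h1 : Measurable fun z : (Param d × Param d) × Seed d n => spread t z.1.1 z.1.2 j :=
    (measurable_spread t j).comp measurable_fst
  have h2 : Measurable fun z : (Param d × Param d) × Seed d n =>
      batchGrad f D c z.2.1 z.1.1 :=
    (measurable_batchGrad f D c).comp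
      ((by fun_prop : Measurable fun z : (Param d × Param d) × Seed d n => (z.2.1, z.1.1)))
  fun_prop

end Measurability

/-- The update with mixing weights `α` and noisy gradient `v`. -/
def move {d : ℕ} (γ t : ℝ) (a b : Param d) (α : Fin d → ℝ) (v : Param d) : Param d :=
  WithLp.toLp 2 fun j => α j * (a j + spread t a b j) + (1 - α j) * (b j - spread t a b j) - γ * v j

lemma step_eq_move {Z : Type*} {d n : ℕ} (f : Param d → Z → ℝ) (D : Fin n → Z) (c γ t : ℝ)
    (s : Seed d n) (a b : Param d) :
    step f D c γ t s a b = move γ t a b s.2.1 (batchGrad f D c s.1 a + s.2.2) := rfl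

lemma measurable_move {d : ℕ} (γ t : ℝ) (a b : Param d) :
    Measurable fun z : (Fin d → ℝ) × Param d => move γ t a b z.1 z.2 := by
  unfold move
  fun_prop

instance {d : ℕ} : IsProbabilityMeasure
    (Measure.pi fun _ : Fin d => (volume : Measure ℝ).restrict (Icc 0 1)) := by
  have : IsProbabilityMeasure ((volume : Measure ℝ).restrict (Icc 0 1)) := ⟨by simp⟩
  infer_instance

lemma batchGrad_insertNth {Z : Type*} {d n : ℕ} (f : Param d → Z → ℝ) (D : Fin n → Z) (c : ℝ)
    (i : Fin (n + 1)) (z : Z) (β : Bool) (m : Fin n → Bool) (w : Param d) :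
    batchGrad f (i.insertNth z D) c (i.insertNth β m) w
      = (if β then clip c (sampleGrad f w z) else 0) + batchGrad f D c m w := by
  simp [batchGrad, Fin.sum_univ_succAbove _ i]

/-! ### Privacy of one iteration -/

section OneStep

variable {Z : Type*} {d n : ℕ} (f : Param d → Z → ℝ) (D : Fin n → Z) (c γ t : ℝ)
  (q : unitInterval) (ν : Measure (Param d)) [IsProbabilityMeasure ν]

/-- The law of the selection of one further record, of the mask, and of the mixing weights. -/
def maskLaw (d n : ℕ) (q : unitInterval) : Measure ((Bool × (Fin n → Bool)) × (Fin d → ℝ)) :=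
  ((bernoulliMeasure true false q).prod
    (Measure.pi fun _ : Fin n => bernoulliMeasure true false q)).prod
      (Measure.pi fun _ : Fin d => (volume : Measure ℝ).restrict (Icc 0 1))

instance : IsProbabilityMeasure (maskLaw d n q) := by unfold maskLaw; infer_instance

/-- Together with `lintegral_seedLaw_succ` this couples neighbouring datasets: both seeds are read
off the same `maskLaw`, the smaller one ignoring the additional selection bit, and the noise is
integrated last. -/
lemma lintegral_seedLaw {g : Seed d n → ℝ≥0∞} (hg : Measurable g) :
    ∫⁻ s, g s ∂(seedLaw n q ν)
      = ∫⁻ x, ∫⁻ y, g (x.1.2, x.2, y) ∂ν ∂(maskLaw d n q) := by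
  have h : MeasurePreserving
      (fun z : ((Bool × (Fin n → Bool)) × (Fin d → ℝ)) × Param d => (z.1.1.2, z.1.2, z.2))
      ((maskLaw d n q).prod ν) (seedLaw n q ν) :=
    (measurePreserving_prodAssoc _ _ _).comp
      (((measurePreserving_snd).prod (MeasurePreserving.id _)).prod (MeasurePreserving.id _))
  exact (h.lintegral_comp hg).symm.trans (lintegral_prod _ (hg.comp h.measurable).aemeasurable)

lemma lintegral_seedLaw_succ (i : Fin (n + 1)) {g : Seed d (n + 1) → ℝ≥0∞} (hg : Measurable g) :
    ∫⁻ s, g s ∂(seedLaw (n + 1) q ν)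
      = ∫⁻ x, ∫⁻ y, g (i.insertNth x.1.1 x.1.2, x.2, y) ∂ν ∂(maskLaw d n q) := by
  have h : MeasurePreserving
      (fun z : ((Bool × (Fin n → Bool)) × (Fin d → ℝ)) × Param d =>
        ((i.insertNth z.1.1.1 z.1.1.2 : Fin (n + 1) → Bool), z.1.2, z.2))
      ((maskLaw d n q).prod ν) (seedLaw (n + 1) q ν) :=
    (measurePreserving_prodAssoc _ _ _).comp
      ((((measurePreserving_piFinSuccAbove
        (fun _ : Fin (n + 1) => bernoulliMeasure true false q) i).symm).prod
          (MeasurePreserving.id _)).prod (MeasurePreserving.id _))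
  exact (h.lintegral_comp hg).symm.trans (lintegral_prod _ (hg.comp h.measurable).aemeasurable)

variable {f c q ν}

lemma measurable_step_right (a b : Param d) :
    Measurable fun s : Seed d n => step f D c γ t s a b :=
  (measurable_step f D c γ t).comp (measurable_prodMk_left (x := (a, b)))

/-- With the masks and mixing weights fixed, the two updates differ only by a shift of the noise by
the clipped gradient of the extra record (or by zero); averaging over the fixed part costs nothing.
-/
lemma holderDominated_step {p l : ℝ} (hpl : p.HolderConjugate l) {C : ℝ≥0∞} (hc : 0 ≤ c)
    (hν : ∀ h : Param d, ‖h‖ ≤ c → HolderDominated p C (ν.map fun x => x + h) ν)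
    (i : Fin (n + 1)) (z : Z) (a b : Param d) :
    HolderDominated p C
      ((seedLaw (n + 1) q ν).map fun s => step f (i.insertNth z D) c γ t s a b)
      ((seedLaw n q ν).map fun s => step f D c γ t s a b) ∧
    HolderDominated p C
      ((seedLaw n q ν).map fun s => step f D c γ t s a b)
      ((seedLaw (n + 1) q ν).map fun s => step f (i.insertNth z D) c γ t s a b) := by
  have hm := measurable_step_right (f := f) (c := c) D γ t a b
  have hm' := measurable_step_right (f := f) (c := c) (i.insertNth z D : Fin (n + 1) → Z) γ t a b
  set e : Bool → Param d := fun β => if β then clip c (sampleGrad f a z) else 0 with he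
  have hen : ∀ β, ‖e β‖ ≤ c := by
    intro β
    cases β
    · simpa [he] using hc
    · simpa [he] using norm_clip_le hc _
  have hbm : Measurable fun m : Fin n → Bool => batchGrad f D c m a :=
    (measurable_batchGrad f D c).comp measurable_prodMk_right
  have hA : ∀ g : Param d → ℝ≥0∞, Measurable g →
      ∫⁻ w, g w ∂((seedLaw n q ν).map fun s => step f D c γ t s a b)
        = ∫⁻ x, ∫⁻ y, g (move γ t a b x.2 (batchGrad f D c x.1.2 a + y)) ∂ν ∂(maskLaw d n q) := by
    intro g hg
    rw [lintegral_map hg hm]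
    exact lintegral_seedLaw q ν (hg.comp hm)
  have hB : ∀ g : Param d → ℝ≥0∞, Measurable g →
      ∫⁻ w, g w ∂((seedLaw (n + 1) q ν).map fun s => step f (i.insertNth z D) c γ t s a b)
        = ∫⁻ x, ∫⁻ y, g (move γ t a b x.2 (batchGrad f D c x.1.2 a + (y + e x.1.1))) ∂ν
          ∂(maskLaw d n q) := by
    intro g hg
    rw [lintegral_map hg hm']
    refine (lintegral_seedLaw_succ q ν i (hg.comp hm')).trans ?_
    simp only [Function.comp_apply, step_eq_move, batchGrad_insertNth, he]
    refine lintegral_congr fun x => lintegral_congr fun y => ?_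
    congr 2; abel
  have hM : ∀ (α : Fin d → ℝ) (u : Param d), Measurable fun y => move γ t a b α (u + y) :=
    fun α u => (measurable_move γ t a b).comp
      (by fun_prop : Measurable fun y : Param d => (α, u + y))
  have hadd : ∀ u : Param d, Measurable fun y : Param d => y + u := fun u => by fun_prop
  have hem : Measurable e := measurable_of_countable _
  constructor
  · intro g hg
    have hgp : Measurable fun w => g w ^ p := hg.pow_const p
    rw [hB g hg, hA _ hgp]
    refine lintegral_le_mul_lintegral_rpow hpl _ ?_ fun x => ?_
    · refine Measurable.lintegral_prod_right' (f := fun z :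
        ((Bool × (Fin n → Bool)) × (Fin d → ℝ)) × Param d =>
          g (move γ t a b z.1.2 (batchGrad f D c z.1.1.2 a + z.2)) ^ p) ?_
      have h1 : Measurable fun z : ((Bool × (Fin n → Bool)) × (Fin d → ℝ)) × Param d =>
        batchGrad f D c z.1.1.2 a := hbm.comp (by fun_prop)
      exact hgp.comp ((measurable_move γ t a b).comp
        (by fun_prop : Measurable fun z : ((Bool × (Fin n → Bool)) × (Fin d → ℝ)) × Param d =>
          (z.1.2, batchGrad f D c z.1.1.2 a + z.2)))
    · have := hν (e x.1.1) (hen _) _ (hg.comp (hM x.2 (batchGrad f D c x.1.2 a)))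
      rwa [lintegral_map (hg.comp (hM x.2 _)) (hadd _)] at this
  · intro g hg
    have hgp : Measurable fun w => g w ^ p := hg.pow_const p
    rw [hA g hg, hB _ hgp]
    refine lintegral_le_mul_lintegral_rpow hpl _ ?_ fun x => ?_
    · refine Measurable.lintegral_prod_right' (f := fun z :
        ((Bool × (Fin n → Bool)) × (Fin d → ℝ)) × Param d =>
          g (move γ t a b z.1.2 (batchGrad f D c z.1.1.2 a + (z.2 + e z.1.1.1))) ^ p) ?_
      have h1 : Measurable fun z : ((Bool × (Fin n → Bool)) × (Fin d → ℝ)) × Param d =>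
        e z.1.1.1 := hem.comp (by fun_prop)
      have h2 : Measurable fun z : ((Bool × (Fin n → Bool)) × (Fin d → ℝ)) × Param d =>
        batchGrad f D c z.1.1.2 a := hbm.comp (by fun_prop)
      exact hgp.comp ((measurable_move γ t a b).comp
        (by fun_prop : Measurable fun z : ((Bool × (Fin n → Bool)) × (Fin d → ℝ)) × Param d =>
          (z.1.2, batchGrad f D c z.1.1.2 a + (z.2 + e z.1.1.1))))
    · have h1 := (hM x.2 (batchGrad f D c x.1.2 a)).comp (hadd (e x.1.1))
      -- In this direction the reference law carries the shift `e`; moving the shift to the test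
      -- function turns the comparison into one with shift `-e`.
      have := hν (-e x.1.1) (by simpa using hen _) _ (hg.comp h1)
      rw [lintegral_map (hg.comp h1) (hadd _)] at this
      simpa using this

end OneStep

/-! ### Privacy of the released trajectory -/

section Trajectory

variable {Z : Type*} {d n : ℕ} (f : Param d → Z → ℝ) (D : Fin n → Z) (c γ : ℝ) (τ : ℕ → ℝ)

/-- Extend the history of states after iteration `k` by one iteration. -/
def histStep (k : ℕ) (x : ℕ → Param d × Param d) (s : Seed d n) : ℕ → Param d × Param d :=
  fun j => if j ≤ k then x j else (step f D c γ (τ (k + 1)) s (x k).1 (x k).2, (x k).1)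

lemma measurable_histStep (k : ℕ) :
    Measurable fun z : (ℕ → Param d × Param d) × Seed d n => histStep f D c γ τ k z.1 z.2 := by
  refine measurable_pi_lambda _ fun j => ?_
  unfold histStep
  by_cases h : j ≤ k
  · simp only [h, if_true]; fun_prop
  · simp only [h, if_false]
    refine Measurable.prodMk ?_ (by fun_prop)
    exact (measurable_step f D c γ (τ (k + 1))).comp
      ((by fun_prop : Measurable fun z : (ℕ → Param d × Param d) × Seed d n =>
        (((z.1 k).1, (z.1 k).2), z.2)))

/-- The whole history is made the state of a Markov chain, so that composition covers the release of
all iterates and not just the last. Indices beyond the current time merely repeat the newest state.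
-/
lemma chain_histStep (w₀ wm : Param d) (ω : ℕ → Seed d n) {j k : ℕ} (h : j ≤ k) :
    chain (histStep f D c γ τ) (fun _ => (w₀, wm)) ω k j = states f D c γ τ w₀ wm ω j := by
  induction k generalizing j with
  | zero =>
    obtain rfl : j = 0 := by omega
    rfl
  | succ k ih =>
    rw [chain, histStep]
    split_ifs with hj
    · exact ih hj
    · obtain rfl : j = k + 1 := by omega
      rw [ih le_rfl]
      rfl

lemma trajLaw_eq_map_chain (w₀ wm : Param d) (q : unitInterval) (ν : Measure (Param d))
    [IsProbabilityMeasure ν] (T : ℕ) :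
    trajLaw f D c γ τ w₀ wm q ν T
      = ((Measure.infinitePi fun _ => seedLaw n q ν).map
          fun ω => chain (histStep f D c γ τ) (fun _ => (w₀, wm)) ω T).map
            fun x (k : Fin T) => (x (k + 1)).1 := by
  rw [Measure.map_map (by fun_prop) (measurable_chain (measurable_histStep f D c γ τ) _ _)]
  unfold trajLaw runLaw
  congr 1
  ext ω k : 2
  simp only [Function.comp_apply]
  rw [chain_histStep _ _ _ _ _ _ _ _ (by omega)]
  rfl

variable {f D c γ τ}

lemma holderDominated_trajLaw {p l : ℝ} (hpl : p.HolderConjugate l) {C : ℝ≥0∞} (hc : 0 ≤ c)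
    {ν : Measure (Param d)} [IsProbabilityMeasure ν] {T : ℕ}
    (hν : T ≠ 0 → ∀ h : Param d, ‖h‖ ≤ c → HolderDominated p C (ν.map fun x => x + h) ν)
    (w₀ wm : Param d) (q : unitInterval) (i : Fin (n + 1)) (z : Z) :
    HolderDominated p (C ^ T) (trajLaw f (i.insertNth z D : Fin (n + 1) → Z) c γ τ w₀ wm q ν T)
      (trajLaw f D c γ τ w₀ wm q ν T) ∧
    HolderDominated p (C ^ T) (trajLaw f D c γ τ w₀ wm q ν T)
      (trajLaw f (i.insertNth z D : Fin (n + 1) → Z) c γ τ w₀ wm q ν T) := by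
  have hφ : Measurable fun (x : ℕ → Param d × Param d) (k : Fin T) => (x (k + 1)).1 := by fun_prop
  -- For a fixed history, extending it is post-processing of the single new iterate, so the one-step
  -- bound applies.
  have hfac : ∀ {m : ℕ} (D₁ : Fin m → Z) (k : ℕ) (y : ℕ → Param d × Param d),
      (seedLaw m q ν).map (histStep f D₁ c γ τ k y)
        = ((seedLaw m q ν).map fun s => step f D₁ c γ (τ (k + 1)) s (y k).1 (y k).2).map
          fun w j => if j ≤ k then y j else (w, (y k).1) := by
    intro m D₁ k y
    rw [Measure.map_map _ (measurable_step_right D₁ γ _ _ _)]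
    · rfl
    · refine measurable_pi_lambda _ fun j => ?_
      by_cases h : j ≤ k <;> simp only [h, if_true, if_false] <;> fun_prop
  have hmj : ∀ (k : ℕ) (y : ℕ → Param d × Param d), Measurable
      fun (w : Param d) (j : ℕ) => if j ≤ k then y j else (w, (y k).1) := by
    intro k y
    refine measurable_pi_lambda _ fun j => ?_
    by_cases h : j ≤ k <;> simp only [h, if_true, if_false] <;> fun_prop
  rw [trajLaw_eq_map_chain, trajLaw_eq_map_chain]
  constructor
  · refine (HolderDominated.chain hpl.ne_zero (measurable_histStep f _ c γ τ)
      (measurable_histStep f _ c γ τ) _ _ _ T fun k hk y => ?_).map hφ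
    rw [hfac, hfac]
    exact (holderDominated_step D γ _ hpl hc (hν (by omega)) i z _ _).1.map (hmj k y)
  · refine (HolderDominated.chain hpl.ne_zero (measurable_histStep f _ c γ τ)
      (measurable_histStep f _ c γ τ) _ _ _ T fun k hk y => ?_).map hφ
    rw [hfac, hfac]
    exact (holderDominated_step D γ _ hpl hc (hν (by omega)) i z _ _).2.map (hmj k y)

end Trajectory

/-! ### Gaussian noise: domination and second moment -/

section GaussianNoise

lemma holderDominated_gaussNoise {p l : ℝ} (hpl : p.HolderConjugate l) {d : ℕ}
    {V c ε δ : ℝ} {T : ℕ} (hs : 0 < V * (c ^ 2 * T * Real.log (1 / δ) / ε ^ 2))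
    {h : Param d} (hh : ‖h‖ ≤ c) :
    HolderDominated p (ENNReal.ofReal (Real.exp
        ((l - 1) / 2 * (c ^ 2 / (V * (c ^ 2 * T * Real.log (1 / δ) / ε ^ 2))))))
      ((gaussNoise d V c ε δ T).map fun x => x + h) (gaussNoise d V c ε δ T) := by
  set v := V * (c ^ 2 * T * Real.log (1 / δ) / ε ^ 2) with hv
  have hsq : √v ≠ 0 := (Real.sqrt_pos.2 hs).ne'
  have key := (holderDominated_stdGaussian hpl ((√v)⁻¹ • h)).map
    (φ := fun x => √v • x) (by fun_prop)
  have e : ((stdGaussian (Param d)).map fun x => x + (√v)⁻¹ • h).map (fun x => √v • x)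
      = (gaussNoise d V c ε δ T).map fun x => x + h := by
    rw [gaussNoise, Measure.map_map (by fun_prop) (by fun_prop),
      Measure.map_map (by fun_prop) (by fun_prop)]
    congr 1
    ext x : 1
    simp only [Function.comp_apply, ← hv, smul_add, smul_smul, mul_inv_cancel₀ hsq, one_smul]
  rw [e] at key
  intro g hg
  refine (key g hg).trans ?_
  have hl := hpl.symm.lt
  gcongr ?_ * _
  · refine ENNReal.ofReal_le_ofReal (Real.exp_le_exp.2 ?_)
    have h1 : ‖(√v)⁻¹ • h‖ ^ 2 ≤ c ^ 2 / v := by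
      rw [norm_smul, mul_pow, norm_inv, inv_pow, Real.norm_of_nonneg (Real.sqrt_nonneg _),
        Real.sq_sqrt hs.le, inv_mul_eq_div]
      gcongr
    have : 0 ≤ (l - 1) / 2 := by linarith
    gcongr

lemma integral_norm_sq_stdGaussian (d : ℕ) : ∫ x, ‖x‖ ^ 2 ∂(stdGaussian (Param d)) = d := by
  rw [← map_pi_eq_stdGaussian, integral_map (by fun_prop) (by fun_prop)]
  simp_rw [EuclideanSpace.real_norm_sq_eq]
  have h2 : ∀ i : Fin d, Integrable (fun x : Fin d → ℝ => x i ^ 2)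
      (Measure.pi fun _ => gaussianReal 0 1) := by
    intro i
    have := (memLp_id_gaussianReal (μ := 0) (v := 1) 2).integrable_sq
    exact ((measurePreserving_eval (fun _ : Fin d => gaussianReal 0 1) i).integrable_comp
      (g := fun x : ℝ => x ^ 2) (by fun_prop)).2 this
  rw [integral_finsetSum _ fun i _ => h2 i]
  have h3 : ∀ i : Fin d, ∫ x : Fin d → ℝ, x i ^ 2 ∂(Measure.pi fun _ => gaussianReal 0 1) = 1 := by
    intro i
    have e := integral_map (μ := Measure.pi fun _ : Fin d => gaussianReal 0 1)
      (φ := Function.eval i) (f := fun x : ℝ => x ^ 2)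
      (measurable_pi_apply i).aemeasurable (by fun_prop)
    rw [(measurePreserving_eval (fun _ : Fin d => gaussianReal 0 1) i).map_eq] at e
    simp only [Function.eval] at e
    rw [← e]
    have := variance_of_integral_eq_zero (X := id) (μ := gaussianReal 0 1) (by fun_prop) (by simp)
    simpa using this.symm
  simp [h3]

lemma noiseLevel_gaussNoise (d : ℕ) {V c ε δ : ℝ} {T : ℕ}
    (hs : 0 ≤ V * (c ^ 2 * T * Real.log (1 / δ) / ε ^ 2)) :
    NoiseLevel (gaussNoise d V c ε δ T) V c ε δ T := by
  have hid : MemLp id 2 (stdGaussian (Param d)) := IsGaussian.memLp_two_id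
  refine ⟨?_, ?_, ?_⟩
  · rw [gaussNoise, memLp_map_measure_iff (by fun_prop) (by fun_prop)]
    exact hid.const_smul (√(V * (c ^ 2 * T * Real.log (1 / δ) / ε ^ 2)))
  · rw [gaussNoise, integral_map (by fun_prop) (by fun_prop), integral_smul,
      integral_id_stdGaussian, smul_zero]
  · rw [gaussNoise, integral_map (by fun_prop) (by fun_prop)]
    simp_rw [norm_smul, mul_pow, integral_const_mul]
    rw [integral_norm_sq_stdGaussian, Real.norm_of_nonneg (Real.sqrt_nonneg _), Real.sq_sqrt hs]
    exact le_of_eq (by ring)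

end GaussianNoise

/-- Calibration of the Rényi order: with `l - 1 = 2L/ε`, `L = log(1/δ)`, the term `ε(l - 1)` equals
`2L`, and the level `A + 2` makes the composed cost `lb` at most `L`, which leaves `-L = log δ`. -/
theorem isDP_trajLaw {Z : Type*} {d : ℕ} (f : Param d → Z → ℝ) (q : unitInterval)
    {A c γ ε δ : ℝ} (τ : ℕ → ℝ) (w₀ wm : Param d) (T : ℕ) (hA : 0 < A)
    (hc : 0 < c) (hε : 0 < ε) (hδ : 0 < δ) (hδ1 : δ < 1) (hεA : ε ≤ A * Real.log (1 / δ)) :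
    IsDP ε δ fun (n : ℕ) (D : Fin n → Z) =>
      trajLaw f D c γ τ w₀ wm q (gaussNoise d (A + 2) c ε δ T) T := by
  have hL : 0 < Real.log (1 / δ) := Real.log_pos (by rw [lt_div_iff₀ hδ]; linarith)
  set L := Real.log (1 / δ) with hLdef
  set l : ℝ := 1 + 2 * L / ε with hl
  have hl1 : 1 < l := by rw [hl]; linarith [show 0 < 2 * L / ε by positivity]
  have hlp : l.HolderConjugate l.conjExponent := Real.HolderConjugate.conjExponent hl1
  set p := l.conjExponent
  have hpl := hlp.symm
  set b : ℝ := (l - 1) / 2 * (ε ^ 2 / ((A + 2) * L)) with hb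
  have hbnd : l * b - ε * (l - 1) ≤ Real.log δ := by
    have e1 : l * b = (l - 1) * ((ε / 2) * (ε / L + 2) / (A + 2)) := by
      rw [hb, hl]; field_simp
    have e2 : (ε / 2) * (ε / L + 2) / (A + 2) ≤ ε / 2 := by
      rw [div_le_iff₀ (by linarith)]
      have : ε / L ≤ A := by rwa [div_le_iff₀ hL]
      gcongr
    have e3 : (l - 1) * (ε / 2) = L := by rw [hl]; field_simp; ring
    have e4 : Real.log δ = -L := by rw [hLdef, one_div, Real.log_inv, neg_neg]
    have : (l - 1) * ((ε / 2) * (ε / L + 2) / (A + 2)) ≤ (l - 1) * (ε / 2) := by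
      have : 0 ≤ l - 1 := by linarith
      gcongr
    rw [e1, e4]; linarith
  set C : ℝ≥0∞ := ENNReal.ofReal (Real.exp
        ((l - 1) / 2 * (c ^ 2 / ((A + 2) * (c ^ 2 * T * L / ε ^ 2))))) with hC
  have hCT : C ^ T ≤ ENNReal.ofReal (Real.exp b) := by
    rw [hC, ← ENNReal.ofReal_pow (Real.exp_pos _).le, ← Real.exp_nat_mul]
    refine ENNReal.ofReal_le_ofReal (Real.exp_le_exp.2 ?_)
    -- For `T = 0` the noise is degenerate and dominates no shift, but no step is taken; this is why
    -- the one-step hypothesis is only required for `T ≠ 0`.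
    rcases Nat.eq_zero_or_pos T with h | h
    · subst h
      have : 0 ≤ l - 1 := by linarith
      simp only [CharP.cast_eq_zero, zero_mul]
      positivity
    · refine le_of_eq ?_
      have : (T : ℝ) ≠ 0 := by positivity
      rw [hb]
      field_simp
  have hν : T ≠ 0 → ∀ h : Param d, ‖h‖ ≤ c → HolderDominated p C
      ((gaussNoise d (A + 2) c ε δ T).map fun x => x + h) (gaussNoise d (A + 2) c ε δ T) := by
    intro hT h hh
    have : (0 : ℝ) < T := by positivity
    exact holderDominated_gaussNoise hpl (by positivity) hh
  intro n D i z S hS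
  obtain ⟨h1, h2⟩ := holderDominated_trajLaw (f := f) (D := D) (γ := γ) (τ := τ) hpl hc.le hν
    w₀ wm q i z
  have hw : ∀ {P Q : Measure (Fin T → Param d)}, HolderDominated p (C ^ T) P Q →
      HolderDominated p (ENNReal.ofReal (Real.exp b)) P Q :=
    fun h g hg => (h g hg).trans (by gcongr)
  exact ⟨(hw h2).measure_le hpl hbnd hδ hS, (hw h1).measure_le hpl hbnd hδ hS⟩

/-! ### Smooth bounded functions -/

section Smooth

variable {d : ℕ} {β : ℝ} {F : Param d → ℝ}

/-- The quadratic bound is used at both base points `x`, `y` and two test points symmetric about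
their midpoint. In the alternating sum all values of `F` cancel, leaving `2⟪g, u⟫ ≤ 2β(‖e‖² +
‖u‖²)`; the choice `u = g/(2β)` is optimal. Convexity plays no role. -/
lemma IsSmooth.norm_gradient_sub_le (h : IsSmooth β F) (hβ : 0 < β) (x y : Param d) :
    ‖gradient F x - gradient F y‖ ≤ β * ‖x - y‖ := by
  set g := gradient F x - gradient F y with hg
  set e := (1 / 2 : ℝ) • (y - x) with he
  set u := (1 / (2 * β)) • g with hu
  have a1 := (abs_le.1 (h.2 x (x + (e - u)))).2
  have a2 := (abs_le.1 (h.2 y (x + (e - u)))).1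
  have a3 := (abs_le.1 (h.2 y (y - (e - u)))).2
  have a4 := (abs_le.1 (h.2 x (y - (e - u)))).1
  have s1 : x + (e - u) - x = e - u := by abel
  have s2 : x + (e - u) - y = -e - u := by rw [he]; module
  have s3 : y - (e - u) - y = -(e - u) := by abel
  have s4 : y - (e - u) - x = e + u := by rw [he]; module
  rw [s1] at a1; rw [s2] at a2; rw [s3] at a3; rw [s4] at a4
  have n1 : ‖-e - u‖ ^ 2 = ‖e + u‖ ^ 2 := by rw [← norm_neg]; congr 2; abel
  rw [n1] at a2; rw [norm_neg] at a3
  have par : ‖e - u‖ ^ 2 + ‖e + u‖ ^ 2 = 2 * (‖e‖ ^ 2 + ‖u‖ ^ 2) := by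
    rw [@norm_sub_sq_real, @norm_add_sq_real]; ring
  simp only [inner_sub_right, inner_add_right, inner_neg_right] at a1 a2 a3 a4
  have hgu : ⟪gradient F x, u⟫ - ⟪gradient F y, u⟫ = ‖g‖ ^ 2 / (2 * β) := by
    rw [← inner_sub_left, ← hg, hu, inner_smul_right, real_inner_self_eq_norm_sq]; ring
  have nu : ‖u‖ ^ 2 = ‖g‖ ^ 2 / (4 * β ^ 2) := by
    rw [hu, norm_smul, mul_pow, Real.norm_eq_abs, sq_abs]; field_simp; ring
  have ne : ‖e‖ ^ 2 = ‖x - y‖ ^ 2 / 4 := by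
    rw [he, norm_smul, mul_pow, Real.norm_eq_abs, sq_abs, norm_sub_rev]; ring
  have key : 2 * (‖g‖ ^ 2 / (2 * β)) ≤ 2 * β * (‖x - y‖ ^ 2 / 4 + ‖g‖ ^ 2 / (4 * β ^ 2)) := by
    rw [← ne, ← nu, ← hgu]
    nlinarith
  have k2 : ‖g‖ ^ 2 ≤ (β * ‖x - y‖) ^ 2 := by
    have e1 : 2 * β * (‖x - y‖ ^ 2 / 4 + ‖g‖ ^ 2 / (4 * β ^ 2))
        = β * ‖x - y‖ ^ 2 / 2 + ‖g‖ ^ 2 / (2 * β) := by field_simp; ring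
    have e2 : ‖g‖ ^ 2 / (2 * β) ≤ β * ‖x - y‖ ^ 2 / 2 := by linarith
    rw [div_le_iff₀ (by positivity)] at e2
    nlinarith
  exact le_of_sq_le_sq k2 (by positivity)

lemma IsSmooth.continuous_gradient (h : IsSmooth β F) (hβ : 0 < β) : Continuous (gradient F) := by
  refine (LipschitzWith.of_dist_le_mul (K := β.toNNReal) fun x y => ?_).continuous
  rw [dist_eq_norm, dist_eq_norm, Real.coe_toNNReal _ hβ.le]
  exact h.norm_gradient_sub_le hβ x y

lemma sub_le_riskGap (ha : BddAbove (range F)) (hb : BddBelow (range F)) (x y : Param d) :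
    F x - F y ≤ riskGap F :=
  sub_le_sub (le_ciSup ha x) (ciInf_le hb y)

/-- A gradient step of size `1/β` lowers `F` by at least `‖∇F‖²/(2β)`, which cannot exceed the gap.
-/
lemma IsSmooth.norm_gradient_le (h : IsSmooth β F) (hβ : 0 < β) (ha : BddAbove (range F))
    (hb : BddBelow (range F)) (x : Param d) : ‖gradient F x‖ ≤ √(2 * β * riskGap F) := by
  refine Real.le_sqrt_of_sq_le ?_
  have h1 := (abs_le.1 (h.2 x (x - (1 / β) • gradient F x))).2
  have h2 := sub_le_riskGap ha hb x (x - (1 / β) • gradient F x)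
  have s1 : x - (1 / β) • gradient F x - x = -((1 / β) • gradient F x) := by abel
  rw [s1, norm_neg, inner_neg_right, inner_smul_right, real_inner_self_eq_norm_sq, norm_smul,
    mul_pow, Real.norm_eq_abs, sq_abs] at h1
  have e : β / 2 * ((1 / β) ^ 2 * ‖gradient F x‖ ^ 2) = ‖gradient F x‖ ^ 2 / β / 2 := by
    field_simp
  have e2 : 1 / β * ‖gradient F x‖ ^ 2 = ‖gradient F x‖ ^ 2 / β := by ring
  rw [e, e2] at h1
  have h3 : ‖gradient F x‖ ^ 2 / β ≤ 2 * riskGap F := by linarith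
  rw [div_le_iff₀ hβ] at h3
  linarith

end Smooth

/-! ### The bias of clipping -/

lemma ncard_setOf_eq_sum {n : ℕ} (p : Fin n → Prop) [DecidablePred p] :
    ({i | p i}.ncard : ℝ) = ∑ i, if p i then 1 else 0 := by
  rw [Set.ncard_eq_toFinset_card']
  simp

/-- Integration of an exponential tail bound. -/
lemma mean_posPart_le {n : ℕ} (X : Fin n → ℝ) {κ : ℝ} (hκ : 0 < κ) (s : ℝ)
    (h : ∀ t, ({i | t ≤ X i}.ncard : ℝ) / n ≤ Real.exp (-t / κ)) :
    (1 / (n : ℝ)) * ∑ i, max (X i - s) 0 ≤ 2 * κ * Real.exp (-s / κ) := by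
  classical
  obtain ⟨J, hJ⟩ : ∃ J : ℕ, ∀ i, ⌊(X i - s) / κ⌋₊ + 1 ≤ J := by
    obtain ⟨J, hJ⟩ := (Set.finite_range fun i => ⌊(X i - s) / κ⌋₊ + 1).bddAbove
    exact ⟨J, fun i => hJ (mem_range_self i)⟩
  -- The tail integral is discretised at scale `κ`: the excess over `s` is at most `κ` times the
  -- number of levels `s + jκ` reached. The level probabilities are then dominated by a geometric
  -- series of ratio `e⁻¹ ≤ 1/2`, whence the factor `2`.
  have h1 : ∀ i, max (X i - s) 0
      ≤ κ * ∑ j ∈ Finset.range J, if s + j * κ ≤ X i then (1 : ℝ) else 0 := by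
    intro i
    have h0 : (0 : ℝ) ≤ ∑ j ∈ Finset.range J, if s + j * κ ≤ X i then (1 : ℝ) else 0 :=
      Finset.sum_nonneg fun j _ => by split_ifs <;> norm_num
    refine max_le ?_ (by positivity)
    by_cases hx : X i - s < 0
    · exact hx.le.trans (by positivity)
    have hx0 : 0 ≤ (X i - s) / κ := div_nonneg (not_lt.1 hx) hκ.le
    have h2 : ((⌊(X i - s) / κ⌋₊ + 1 : ℕ) : ℝ)
        ≤ ∑ j ∈ Finset.range J, if s + j * κ ≤ X i then (1 : ℝ) else 0 := by
      calc ((⌊(X i - s) / κ⌋₊ + 1 : ℕ) : ℝ)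
          = ∑ j ∈ Finset.range (⌊(X i - s) / κ⌋₊ + 1), if s + j * κ ≤ X i then (1 : ℝ) else 0 := by
            rw [Finset.sum_congr rfl (g := fun _ => (1 : ℝ))]
            · simp
            · intro j hj
              have hj' : j ≤ ⌊(X i - s) / κ⌋₊ := by
                have := Finset.mem_range.1 hj; omega
              have := (Nat.le_floor_iff hx0).1 hj'
              rw [le_div_iff₀ hκ] at this
              rw [if_pos (by linarith)]
        _ ≤ _ := Finset.sum_le_sum_of_subset_of_nonneg
            (Finset.range_subset_range.2 (hJ i)) fun j _ _ => by split_ifs <;> norm_num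
    have h3 := (Nat.lt_floor_add_one ((X i - s) / κ)).le
    rw [div_le_iff₀ hκ] at h3
    push_cast at h2
    nlinarith
  have hg : ∑ j ∈ Finset.range J, Real.exp (-(j : ℝ)) ≤ 2 := by
    have he : Real.exp (-1) ≤ 1 / 2 := by
      rw [Real.exp_neg, ← one_div]
      exact one_div_le_one_div_of_le two_pos (by linarith [Real.add_one_le_exp 1])
    calc ∑ j ∈ Finset.range J, Real.exp (-(j : ℝ))
        ≤ ∑ j ∈ Finset.range J, (1 / 2 : ℝ) ^ j := by
          refine Finset.sum_le_sum fun j _ => ?_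
          have : Real.exp (-(j : ℝ)) = Real.exp (-1) ^ j := by
            rw [← Real.exp_nat_mul]; congr 1; ring
          rw [this]
          gcongr
      _ ≤ 2 := sum_geometric_two_le J
  calc (1 / (n : ℝ)) * ∑ i, max (X i - s) 0
      ≤ (1 / (n : ℝ)) * ∑ i, κ * ∑ j ∈ Finset.range J, if s + j * κ ≤ X i then (1 : ℝ) else 0 := by
        gcongr with i; exact h1 i
    _ = κ * ∑ j ∈ Finset.range J, ({i | s + j * κ ≤ X i}.ncard : ℝ) / n := by
        simp_rw [ncard_setOf_eq_sum]
        rw [← Finset.mul_sum, Finset.sum_comm, ← Finset.sum_div]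
        ring
    _ ≤ κ * ∑ j ∈ Finset.range J, Real.exp (-s / κ) * Real.exp (-(j : ℝ)) := by
        gcongr with j
        refine (h _).trans (le_of_eq ?_)
        rw [← Real.exp_add]; congr 1; field_simp; ring
    _ ≤ 2 * κ * Real.exp (-s / κ) := by
        rw [← Finset.mul_sum]
        have := mul_le_mul_of_nonneg_left hg (by positivity : 0 ≤ κ * Real.exp (-s / κ))
        linarith

section Clip

variable {d : ℕ} {c : ℝ}

lemma norm_sub_clip_le (g : Param d) : ‖g - clip c g‖ ≤ max (‖g‖ - c) 0 := by
  rcases eq_or_ne g 0 with rfl | hg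
  · simp [clip]
  have hp : 0 < ‖g‖ := norm_pos_iff.2 hg
  rcases le_total ‖g‖ c with h | h
  · have : min 1 (c / ‖g‖) = 1 := min_eq_left ((one_le_div hp).2 h)
    simp [clip, this]
  · have h1 : min 1 (c / ‖g‖) = c / ‖g‖ := min_eq_right ((div_le_one hp).2 h)
    have h2 : g - clip c g = (1 - c / ‖g‖) • g := by rw [clip, h1, sub_smul, one_smul]
    have h3 : 0 ≤ 1 - c / ‖g‖ := sub_nonneg.2 ((div_le_one hp).2 h)
    rw [h2, norm_smul, Real.norm_of_nonneg h3]
    refine le_max_of_le_left (le_of_eq ?_)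
    field_simp

/-- Here `⟪m, g⟫ ≥ ‖m‖(‖m‖ - c/4)` and `‖g‖ ≤ ‖m‖ + c/4`; if `g` is clipped, the ratio `(‖m‖ -
c/4)/(‖m‖ + c/4)` exceeds `1/3`, and otherwise `‖m‖ - c/4 > c/4`. -/
lemma le_inner_clip (hc : 0 < c) {m g : Param d} (hm : c / 2 < ‖m‖) (hg : ‖g - m‖ ≤ c / 4) :
    c * ‖m‖ / 4 ≤ ⟪m, clip c g⟫ := by
  have hin : ‖m‖ * (‖m‖ - c / 4) ≤ ⟪m, g⟫ := by
    have h1 : ⟪m, g⟫ = ‖m‖ ^ 2 + ⟪m, g - m⟫ := by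
      rw [inner_sub_right, real_inner_self_eq_norm_sq]; ring
    have h2 := (abs_le.1 (abs_real_inner_le_norm m (g - m))).1
    have h3 : ‖m‖ * ‖g - m‖ ≤ ‖m‖ * (c / 4) := by gcongr
    rw [h1]; nlinarith
  have hgn : ‖g‖ ≤ ‖m‖ + c / 4 := by
    calc ‖g‖ = ‖m + (g - m)‖ := by congr 1; abel
      _ ≤ ‖m‖ + ‖g - m‖ := norm_add_le _ _
      _ ≤ _ := by gcongr
  have hg0 : 0 < ‖g‖ := by
    have : ‖m‖ ≤ ‖g‖ + ‖g - m‖ := by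
      calc ‖m‖ = ‖g - (g - m)‖ := by congr 1; abel
        _ ≤ _ := norm_sub_le _ _
    linarith
  have hm0 : 0 < ‖m‖ := by linarith
  rw [clip, inner_smul_right]
  rcases le_total ‖g‖ c with h | h
  · rw [min_eq_left ((one_le_div hg0).2 h)]
    nlinarith
  · rw [min_eq_right ((div_le_one hg0).2 h), div_mul_eq_mul_div, le_div_iff₀ hg0]
    have : c * ‖m‖ / 4 * ‖g‖ ≤ c * ‖m‖ / 4 * (‖m‖ + c / 4) := by gcongr
    have h5 : c * (‖m‖ * (‖m‖ - c / 4)) ≤ c * ⟪m, g⟫ := by gcongr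
    refine this.trans (le_trans ?_ h5)
    have : 0 ≤ c * ‖m‖ * (3 * ‖m‖ - 5 * c / 4) :=
      mul_nonneg (by positivity) (by linarith)
    linarith

end Clip

/-- The average clipped gradient. -/
def meanClip {Z : Type*} {d n : ℕ} (f : Param d → Z → ℝ) (D : Fin n → Z) (c : ℝ) (w : Param d) :
    Param d :=
  (1 / (n : ℝ)) • ∑ i, clip c (sampleGrad f w (D i))

section MeanClip

variable {Z : Type*} {d n : ℕ} {f : Param d → Z → ℝ} {D : Fin n → Z} {c κ : ℝ}

lemma gradient_risk (hf : ∀ i, Differentiable ℝ fun w => f w (D i)) (w : Param d) :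
    gradient (risk f D) w = (1 / (n : ℝ)) • ∑ i, sampleGrad f w (D i) := by
  have h : ∀ i, HasGradientAt (fun u => f u (D i)) (sampleGrad f w (D i)) w :=
    fun i => (hf i w).hasGradientAt
  refine HasGradientAt.gradient ?_
  have h2 := (HasFDerivAt.fun_sum (u := Finset.univ) fun i _ => (h i).hasFDerivAt).const_mul
    (1 / (n : ℝ))
  have h3 : InnerProductSpace.toDual ℝ (Param d) ((1 / (n : ℝ)) • ∑ i, sampleGrad f w (D i))
      = (1 / (n : ℝ)) • ∑ i, InnerProductSpace.toDual ℝ (Param d) (sampleGrad f w (D i)) := by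
    rw [map_smulₛₗ, map_sum]; rfl
  rw [hasGradientAt_iff_hasFDerivAt, h3]
  exact h2

lemma norm_meanClip_le (hc : 0 ≤ c) (w : Param d) : ‖meanClip f D c w‖ ≤ c := by
  rw [meanClip, norm_smul, Real.norm_of_nonneg (by positivity)]
  have h1 : ‖∑ i, clip c (sampleGrad f w (D i))‖ ≤ n * c :=
    (norm_sum_le_of_le _ fun i _ => norm_clip_le hc _).trans (by simp)
  rcases Nat.eq_zero_or_pos n with h | h
  · simp [h, hc]
  · have : (0 : ℝ) < n := by positivity
    calc 1 / (n : ℝ) * ‖∑ i, clip c (sampleGrad f w (D i))‖ ≤ 1 / n * (n * c) := by gcongr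
      _ = c := by field_simp

lemma norm_batchGrad_le (hc : 0 ≤ c) (m : Fin n → Bool) (w : Param d) :
    ‖batchGrad f D c m w‖ ≤ n * c := by
  refine (norm_sum_le_of_le (f := fun i => if m i then clip c (sampleGrad f w (D i)) else 0)
    (n := fun _ => c) _ fun i _ => ?_).trans (by simp)
  split_ifs
  · exact norm_clip_le hc _
  · simpa using hc

/-- Clipping keeps the average gradient a descent direction, up to an exponentially small bias. -/
lemma le_inner_meanClip (hn : 0 < n) (hκ : 0 < κ)
    (hf : ∀ i, Differentiable ℝ fun w => f w (D i)) (hsub : SubExpGrad f D κ)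
    (hc : 4 * κ * Real.log 10 ≤ c) (w : Param d) :
    2 * min (9 / 20 * ‖gradient (risk f D) w‖ ^ 2) (c / 20 * ‖gradient (risk f D) w‖)
        - ‖gradient (risk f D) w‖ * (2 * κ * Real.exp (-c / (2 * κ)))
      ≤ ⟪gradient (risk f D) w, meanClip f D c w⟫ := by
  classical
  have hlog : 0 < Real.log 10 := Real.log_pos (by norm_num)
  have hc0 : 0 < c := lt_of_lt_of_le (by positivity) hc
  have hn0 : (0 : ℝ) < n := by positivity
  set m := gradient (risk f D) w with hm
  set X : Fin n → ℝ := fun i => ‖sampleGrad f w (D i) - m‖ with hX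
  have hbias : 0 ≤ 2 * κ * Real.exp (-c / (2 * κ)) := by positivity
  rcases le_or_gt ‖m‖ (c / 2) with hs | hs
  · have h1 : ‖m - meanClip f D c w‖ ≤ 2 * κ * Real.exp (-c / (2 * κ)) := by
      have e1 : m - meanClip f D c w
          = (1 / (n : ℝ)) • ∑ i, (sampleGrad f w (D i) - clip c (sampleGrad f w (D i))) := by
        rw [hm, gradient_risk hf, meanClip, Finset.sum_sub_distrib, smul_sub]
      rw [e1, norm_smul, Real.norm_of_nonneg (by positivity)]
      calc 1 / (n : ℝ) * ‖∑ i, (sampleGrad f w (D i) - clip c (sampleGrad f w (D i)))‖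
          ≤ 1 / (n : ℝ) * ∑ i, max (X i - c / 2) 0 := by
            gcongr
            refine norm_sum_le_of_le _ fun i _ => (norm_sub_clip_le _).trans ?_
            refine max_le_max ?_ le_rfl
            have : ‖sampleGrad f w (D i)‖ ≤ ‖m‖ + X i := by
              calc ‖sampleGrad f w (D i)‖ = ‖m + (sampleGrad f w (D i) - m)‖ := by congr 1; abel
                _ ≤ _ := norm_add_le _ _
            linarith
        _ ≤ 2 * κ * Real.exp (-(c / 2) / κ) := mean_posPart_le X hκ _ (hsub w)
        _ = _ := by congr 2; field_simp
    have h2 : ⟪m, meanClip f D c w⟫ = ‖m‖ ^ 2 - ⟪m, m - meanClip f D c w⟫ := by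
      rw [inner_sub_right, real_inner_self_eq_norm_sq]; ring
    have h3 := (real_inner_le_norm m (m - meanClip f D c w)).trans
      (mul_le_mul_of_nonneg_left h1 (norm_nonneg m))
    have h4 := min_le_left (9 / 20 * ‖m‖ ^ 2) (c / 20 * ‖m‖)
    rw [h2]
    nlinarith [sq_nonneg ‖m‖]
  -- The threshold `4κ log 10` is chosen for this. Good records contribute at least `c‖m‖/4` and bad
  -- ones at least `-c‖m‖`, so the mean is at least `(1/4 - (5/4)/10) c‖m‖ = c‖m‖/8`, more than the
  -- required `c‖m‖/10`.
  · have hbad : ({i | c / 4 ≤ X i}.ncard : ℝ) / n ≤ 1 / 10 := by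
      refine (hsub w (c / 4)).trans ?_
      rw [show (1 / 10 : ℝ) = Real.exp (-Real.log 10) by
        rw [Real.exp_neg, Real.exp_log (by norm_num)]; norm_num]
      refine Real.exp_le_exp.2 ?_
      rw [neg_div, neg_le_neg_iff, le_div_iff₀ hκ]
      linarith
    have h1 : ∀ i, c * ‖m‖ / 4 - 5 / 4 * (c * ‖m‖) * (if c / 4 ≤ X i then 1 else 0)
        ≤ ⟪m, clip c (sampleGrad f w (D i))⟫ := by
      intro i
      split_ifs with h
      · have := (abs_le.1 (abs_real_inner_le_norm m (clip c (sampleGrad f w (D i))))).1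
        have h2 := mul_le_mul_of_nonneg_left (norm_clip_le hc0.le (sampleGrad f w (D i)))
          (norm_nonneg m)
        linarith
      · have := le_inner_clip hc0 hs (not_le.1 h).le
        linarith
    have h2 : c * ‖m‖ / 4 - 5 / 4 * (c * ‖m‖) * (({i | c / 4 ≤ X i}.ncard : ℝ) / n)
        ≤ ⟪m, meanClip f D c w⟫ := by
      rw [meanClip, inner_smul_right, inner_sum]
      refine le_trans (le_of_eq ?_) (mul_le_mul_of_nonneg_left
        (Finset.sum_le_sum fun i _ => h1 i) (by positivity : 0 ≤ 1 / (n : ℝ)))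
      rw [Finset.sum_sub_distrib, ← Finset.mul_sum, ncard_setOf_eq_sum]
      simp
      field_simp
    have h3 := mul_le_mul_of_nonneg_left hbad (by positivity : 0 ≤ 5 / 4 * (c * ‖m‖))
    have h4 := min_le_right (9 / 20 * ‖m‖ ^ 2) (c / 20 * ‖m‖)
    have h5 : 0 ≤ ‖m‖ * (2 * κ * Real.exp (-c / (2 * κ))) := by positivity
    have h6 : 0 ≤ c * ‖m‖ := by positivity
    linarith

end MeanClip

/-! ### A drift inequality for chains -/

section Drift

variable {E S : Type*} [MeasurableSpace E] [MeasurableSpace S]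

/-- Telescoping of a one-step drift condition. Integrability comes along by induction: `M` is
dominated by `P + K` because the next expected potential is nonnegative, and the next `P` is
integrable by the drift bound itself. -/
lemma integrable_chain_and_sum_le {Ψ : ℕ → E → S → E}
    (hΨ : ∀ k, Measurable fun z : E × S => Ψ k z.1 z.2) (x : E) (μ : Measure S)
    [IsProbabilityMeasure μ] {P M : E → ℝ} (hP : Measurable P) (hM : Measurable M)
    (hP0 : ∀ y, 0 ≤ P y) (hM0 : ∀ y, 0 ≤ M y) {K : ℕ → ℝ}
    (h : ∀ k y, Integrable (fun s => P (Ψ k y s)) μ ∧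
      ∫ s, P (Ψ k y s) ∂μ ≤ P y - M y + K k) (T : ℕ) :
    Integrable (fun ω => P (chain Ψ x ω T)) (Measure.infinitePi fun _ => μ) ∧
    (∀ k < T, Integrable (fun ω => M (chain Ψ x ω k)) (Measure.infinitePi fun _ => μ)) ∧
    ∫ ω, P (chain Ψ x ω T) ∂(Measure.infinitePi fun _ => μ)
      + ∑ k ∈ Finset.range T, ∫ ω, M (chain Ψ x ω k) ∂(Measure.infinitePi fun _ => μ)
      ≤ P x + ∑ k ∈ Finset.range T, K k := by
  induction T with
  | zero => simp [chain]
  | succ T ih =>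
    obtain ⟨ih1, ih2, ih3⟩ := ih
    have hMT : Integrable (fun ω => M (chain Ψ x ω T)) (Measure.infinitePi fun _ => μ) := by
      refine (ih1.add (integrable_const (K T))).mono'
        (hM.comp (measurable_chain hΨ x T)).aestronglyMeasurable
        (Filter.Eventually.of_forall fun ω => ?_)
      have h1 := (h T (chain Ψ x ω T)).2
      have h2 : 0 ≤ ∫ s, P (Ψ T (chain Ψ x ω T) s) ∂μ := integral_nonneg fun s => hP0 _
      rw [Real.norm_of_nonneg (hM0 _)]
      simp only [Pi.add_apply]
      linarith
    have hmeas : Measurable fun ω : ℕ → S => P (chain Ψ x ω (T + 1)) :=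
      hP.comp (measurable_chain hΨ x _)
    have hpres := measurePreserving_update_infinitePi μ T
    have hcomp : ((fun ω : ℕ → S => P (chain Ψ x ω (T + 1))) ∘
        fun z : (ℕ → S) × S => Function.update z.1 T z.2)
        = fun z => P (Ψ T (chain Ψ x z.1 T) z.2) := by
      ext z
      simp [chain, chain_update]
    have hmz : Measurable fun z : (ℕ → S) × S => P (Ψ T (chain Ψ x z.1 T) z.2) :=
      hcomp ▸ hmeas.comp hpres.measurable
    have hbound : Integrable (fun ω => P (chain Ψ x ω T) - M (chain Ψ x ω T) + K T)
        (Measure.infinitePi fun _ => μ) := (ih1.sub hMT).add (integrable_const _)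
    have hint : Integrable (fun z : (ℕ → S) × S => P (Ψ T (chain Ψ x z.1 T) z.2))
        ((Measure.infinitePi fun _ => μ).prod μ) := by
      rw [integrable_prod_iff hmz.aestronglyMeasurable]
      refine ⟨Filter.Eventually.of_forall fun ω => (h T (chain Ψ x ω T)).1, ?_⟩
      refine hbound.mono' hmz.aestronglyMeasurable.norm.integral_prod_right'
        (Filter.Eventually.of_forall fun ω => ?_)
      rw [Real.norm_of_nonneg (integral_nonneg fun s => norm_nonneg _)]
      simp only [Real.norm_of_nonneg (hP0 _)]
      exact (h T _).2
    have hsucc : Integrable (fun ω => P (chain Ψ x ω (T + 1)))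
        (Measure.infinitePi fun _ => μ) :=
      (hpres.integrable_comp hmeas.aestronglyMeasurable).1 (by rw [hcomp]; exact hint)
    have hval : ∫ ω, P (chain Ψ x ω (T + 1)) ∂(Measure.infinitePi fun _ => μ)
        = ∫ ω, ∫ s, P (Ψ T (chain Ψ x ω T) s) ∂μ ∂(Measure.infinitePi fun _ => μ) := by
      have e := integral_map (μ := (Measure.infinitePi fun _ => μ).prod μ)
        (f := fun ω => P (chain Ψ x ω (T + 1))) hpres.measurable.aemeasurable
        hmeas.aestronglyMeasurable
      rw [hpres.map_eq] at e
      rw [e, ← integral_prod _ hint, ← hcomp]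
      rfl
    refine ⟨hsucc, fun k hk => ?_, ?_⟩
    · rcases Nat.lt_succ_iff_lt_or_eq.1 hk with hk | rfl
      · exact ih2 k hk
      · exact hMT
    · have h1 : ∫ ω, P (chain Ψ x ω (T + 1)) ∂(Measure.infinitePi fun _ => μ)
          ≤ ∫ ω, (P (chain Ψ x ω T) - M (chain Ψ x ω T) + K T)
            ∂(Measure.infinitePi fun _ => μ) := by
        rw [hval]
        refine integral_mono_of_nonneg (Filter.Eventually.of_forall fun ω =>
          integral_nonneg fun s => hP0 _) hbound (Filter.Eventually.of_forall fun ω => (h T _).2)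
      have e : ∫ ω, (P (chain Ψ x ω T) - M (chain Ψ x ω T) + K T)
            ∂(Measure.infinitePi fun _ => μ)
          = ∫ ω, P (chain Ψ x ω T) ∂(Measure.infinitePi fun _ => μ)
            - ∫ ω, M (chain Ψ x ω T) ∂(Measure.infinitePi fun _ => μ) + K T := by
        have e1 := integral_add (ih1.sub hMT) (integrable_const (K T))
        have e2 := integral_sub ih1 hMT
        simp only [Pi.sub_apply, integral_const, probReal_univ, one_smul] at e1 e2
        rw [e1, e2]
      rw [Finset.sum_range_succ, Finset.sum_range_succ]
      linarith

end Drift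

/-! ### Moments of the mixing weights and of the sampling mask -/

/-- The law of the mixing weights. -/
abbrev mixLaw (d : ℕ) : Measure (Fin d → ℝ) :=
  Measure.pi fun _ : Fin d => (volume : Measure ℝ).restrict (Icc 0 1)

/-- The centred mixing displacement `(α - 1/2) ⊙ y`. -/
def mixDisp {d : ℕ} (y : Param d) (α : Fin d → ℝ) : Param d :=
  WithLp.toLp 2 fun j => (α j - 1 / 2) * y j

section Mix

variable {d : ℕ}

lemma measurable_mixDisp (y : Param d) : Measurable (mixDisp y) := by
  unfold mixDisp; fun_prop

instance : IsProbabilityMeasure ((volume : Measure ℝ).restrict (Icc 0 1)) := ⟨by simp⟩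

lemma integrable_mixLaw_coord {h : ℝ → ℝ} (hc : Continuous h) (j : Fin d) :
    Integrable (fun α => h (α j)) (mixLaw d) := by
  have h1 : Integrable h ((volume : Measure ℝ).restrict (Icc 0 1)) :=
    hc.continuousOn.integrableOn_compact isCompact_Icc
  exact ((measurePreserving_eval (fun _ : Fin d => (volume : Measure ℝ).restrict (Icc 0 1))
    j).integrable_comp hc.aestronglyMeasurable).2 h1

lemma integral_mixLaw_coord {h : ℝ → ℝ} (hc : Continuous h) (j : Fin d) :
    ∫ α, h (α j) ∂(mixLaw d) = ∫ x in (0 : ℝ)..1, h x := by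
  have hp := measurePreserving_eval (fun _ : Fin d => (volume : Measure ℝ).restrict (Icc 0 1)) j
  have e := integral_map (μ := mixLaw d) (φ := Function.eval j) (f := h)
    (measurable_pi_apply j).aemeasurable hc.aestronglyMeasurable
  rw [hp.map_eq] at e
  rw [intervalIntegral.integral_of_le zero_le_one, ← integral_Icc_eq_integral_Ioc, e]

lemma integrable_inner_mixDisp (y v : Param d) :
    Integrable (fun α => ⟪mixDisp y α, v⟫) (mixLaw d) := by
  simp only [mixDisp, PiLp.inner_apply]
  refine integrable_finsetSum _ fun j _ => ?_
  exact integrable_mixLaw_coord (h := fun x => ⟪(x - 1 / 2) * y j, v j⟫) (by fun_prop) j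

lemma integral_inner_mixDisp (y v : Param d) : ∫ α, ⟪mixDisp y α, v⟫ ∂(mixLaw d) = 0 := by
  simp only [mixDisp, PiLp.inner_apply]
  rw [integral_finsetSum _ fun j _ =>
    integrable_mixLaw_coord (h := fun x => ⟪(x - 1 / 2) * y j, v j⟫) (by fun_prop) j]
  refine Finset.sum_eq_zero fun j _ => ?_
  rw [integral_mixLaw_coord (h := fun x => ⟪(x - 1 / 2) * y j, v j⟫) (by fun_prop) j]
  simp only [RCLike.inner_apply, conj_trivial]
  rw [intervalIntegral.integral_const_mul, intervalIntegral.integral_mul_const,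
    intervalIntegral.integral_sub (by simp) (by simp)]
  simp

lemma integrable_norm_sq_mixDisp (y : Param d) :
    Integrable (fun α => ‖mixDisp y α‖ ^ 2) (mixLaw d) := by
  simp only [EuclideanSpace.real_norm_sq_eq, mixDisp]
  refine integrable_finsetSum _ fun j _ => ?_
  exact integrable_mixLaw_coord (h := fun x => ((x - 1 / 2) * y j) ^ 2) (by fun_prop) j

lemma integral_norm_sq_mixDisp (y : Param d) :
    ∫ α, ‖mixDisp y α‖ ^ 2 ∂(mixLaw d) = ‖y‖ ^ 2 / 12 := by
  simp only [EuclideanSpace.real_norm_sq_eq, mixDisp]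
  rw [integral_finsetSum _ fun j _ =>
    integrable_mixLaw_coord (h := fun x => ((x - 1 / 2) * y j) ^ 2) (by fun_prop) j,
    Finset.sum_div]
  refine Finset.sum_congr rfl fun j _ => ?_
  rw [integral_mixLaw_coord (h := fun x => ((x - 1 / 2) * y j) ^ 2) (by fun_prop) j]
  simp only [mul_pow]
  rw [intervalIntegral.integral_mul_const,
    intervalIntegral.integral_comp_sub_right (fun x => x ^ 2), integral_pow]
  norm_num
  ring

end Mix

section Mask

variable {Z : Type*} {d n : ℕ} (f : Param d → Z → ℝ) (D : Fin n → Z) (c : ℝ) (q : unitInterval)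

lemma integral_inner_batchGrad (w v : Param d) :
    ∫ m, ⟪v, batchGrad f D c m w⟫ ∂(Measure.pi fun _ : Fin n => bernoulliMeasure true false q)
      = q * n * ⟪v, meanClip f D c w⟫ := by
  have h1 : ∀ i : Fin n, Integrable
      (fun m : Fin n → Bool => if m i then ⟪v, clip c (sampleGrad f w (D i))⟫ else 0)
      (Measure.pi fun _ : Fin n => bernoulliMeasure true false q) :=
    fun i => Integrable.of_finite
  have h2 : ∀ m : Fin n → Bool, ⟪v, batchGrad f D c m w⟫
      = ∑ i, if m i then ⟪v, clip c (sampleGrad f w (D i))⟫ else 0 := by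
    intro m
    rw [batchGrad, inner_sum]
    refine Finset.sum_congr rfl fun i _ => ?_
    split_ifs <;> simp
  simp_rw [h2]
  rw [integral_finsetSum _ fun i _ => h1 i, meanClip, inner_smul_right, inner_sum]
  have h3 : ∀ i : Fin n, ∫ m : Fin n → Bool,
      (if m i then ⟪v, clip c (sampleGrad f w (D i))⟫ else 0)
        ∂(Measure.pi fun _ : Fin n => bernoulliMeasure true false q)
      = q * ⟪v, clip c (sampleGrad f w (D i))⟫ := by
    intro i
    have e := integral_map (μ := Measure.pi fun _ : Fin n => bernoulliMeasure true false q)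
      (φ := Function.eval i)
      (f := fun x : Bool => if x then ⟪v, clip c (sampleGrad f w (D i))⟫ else 0)
      (measurable_pi_apply i).aemeasurable (measurable_of_countable _).aestronglyMeasurable
    rw [(measurePreserving_eval (fun _ : Fin n => bernoulliMeasure true false q) i).map_eq] at e
    refine e.symm.trans ?_
    rw [integral_bernoulliMeasure]
    simp
  simp_rw [h3]
  rw [← Finset.mul_sum]
  rcases Nat.eq_zero_or_pos n with h | h
  · subst h; simp
  · have : (n : ℝ) ≠ 0 := by positivity
    field_simp

end Mask

/-! ### The Lyapunov function -/

/-- The difference of the two spread states. -/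
def spreadGap {d : ℕ} (t : ℝ) (a b : Param d) : Param d :=
  WithLp.toLp 2 fun j => a j - b j + 2 * spread t a b j

/-- A coordinate gap `x` with `0 < x < t` becomes `x + t`, and `(x + t)² ≤ x² + 3t²`; a zero gap is
left alone, since its sign is `0`. -/
lemma norm_sq_spreadGap_le {d : ℕ} {t : ℝ} (ht : 0 ≤ t) (a b : Param d) :
    ‖spreadGap t a b‖ ^ 2 ≤ ‖a - b‖ ^ 2 + 3 * (d * t ^ 2) := by
  simp only [EuclideanSpace.real_norm_sq_eq, spreadGap]
  have h : ∀ j, (a j - b j + 2 * spread t a b j) ^ 2 ≤ (a - b) j ^ 2 + 3 * t ^ 2 := by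
    intro j
    simp only [PiLp.sub_apply, spread]
    split_ifs with hj
    · rcases lt_trichotomy (a j - b j) 0 with h | h | h
      · rw [Real.sign_of_neg h]
        rw [abs_of_neg h] at hj
        nlinarith
      · rw [h, Real.sign_zero]; nlinarith [sq_nonneg t]
      · rw [Real.sign_of_pos h]
        rw [abs_of_pos h] at hj
        nlinarith
    · nlinarith [sq_nonneg t]
  calc _ ≤ ∑ j, ((a - b) j ^ 2 + 3 * t ^ 2) := Finset.sum_le_sum fun j _ => h j
    _ = _ := by rw [Finset.sum_add_distrib]; simp; ring

lemma step_eq_add_mixDisp {Z : Type*} {d n : ℕ} (f : Param d → Z → ℝ) (D : Fin n → Z) (c γ t : ℝ)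
    (s : Seed d n) (a b : Param d) :
    step f D c γ t s a b = (1 / 2 : ℝ) • (a + b) + mixDisp (spreadGap t a b) s.2.1
      - γ • (batchGrad f D c s.1 a + s.2.2) := by
  ext j
  simp [step, mixDisp, spreadGap]
  ring

/-- The Lyapunov function `F((2a + b)/3) + (β/9) ‖a - b‖²`: the point `(2 w_k + w_{k-1})/3` has no
drift apart from the gradient step. -/
def potential {d : ℕ} (F : Param d → ℝ) (β : ℝ) (p : Param d × Param d) : ℝ :=
  F ((1 / 3 : ℝ) • ((2 : ℝ) • p.1 + p.2)) + β / 9 * ‖p.1 - p.2‖ ^ 2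

/-- The auxiliary point moves by exactly `(2/3)(r - N)`, and the new difference of states is `r -
((a - b)/2 + N)`. Smoothness at the first and expansion of the square of the second keep every term
linear in `r` explicit, so that these vanish in expectation. -/
lemma potential_le_of_displacement {d : ℕ} {F : Param d → ℝ} {β : ℝ} (hF : IsSmooth β F)
    (hβ : 0 < β) (a b r N : Param d) :
    potential F β ((1 / 2 : ℝ) • (a + b) + r - N, a)
      ≤ F ((1 / 3 : ℝ) • ((2 : ℝ) • a + b)) + β / 27 * ‖a - b‖ ^ 2 + β / 3 * ‖r‖ ^ 2
        + ⟪r, (2 / 3 : ℝ) • gradient F ((1 / 3 : ℝ) • ((2 : ℝ) • a + b)) - (β / 9) • (a - b)⟫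
        - 2 * β / 3 * ⟪r, N⟫
        - 2 / 3 * ⟪gradient F ((1 / 3 : ℝ) • ((2 : ℝ) • a + b)), N⟫ + 2 * β / 3 * ‖N‖ ^ 2 := by
  set u := (1 / 3 : ℝ) • ((2 : ℝ) • a + b) with hu
  set g := gradient F u
  set m := a - b with hm
  simp only [potential]
  set u' := (1 / 3 : ℝ) • ((2 : ℝ) • ((1 / 2 : ℝ) • (a + b) + r - N) + a) with hu'
  have e1 : u' - u = (2 / 3 : ℝ) • (r - N) := by rw [hu', hu]; module
  have e2 : (1 / 2 : ℝ) • (a + b) + r - N - a = r - ((1 / 2 : ℝ) • m + N) := by rw [hm]; module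
  have h1 := (abs_le.1 (hF.2 u u')).2
  rw [e1, norm_smul, mul_pow, Real.norm_eq_abs, sq_abs, inner_smul_right, inner_sub_right,
    @norm_sub_sq_real] at h1
  -- The weight `1/3` instead of `1/4` pays for the cross term and still leaves room for the mixing
  -- variance: `β/27 + β/36 = 7β/108 < β/9`.
  have h2 : ‖(1 / 2 : ℝ) • m + N‖ ^ 2 ≤ ‖m‖ ^ 2 / 3 + 4 * ‖N‖ ^ 2 := by
    have h3 : ‖(1 / 2 : ℝ) • m + N‖ ≤ ‖m‖ / 2 + ‖N‖ := by
      refine (norm_add_le _ _).trans (le_of_eq ?_)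
      rw [norm_smul]; norm_num; ring
    have h4 : ‖(1 / 2 : ℝ) • m + N‖ ^ 2 ≤ (‖m‖ / 2 + ‖N‖) ^ 2 := by gcongr
    nlinarith [sq_nonneg (‖m‖ - 6 * ‖N‖)]
  have h5 : ‖r - ((1 / 2 : ℝ) • m + N)‖ ^ 2
      ≤ ‖r‖ ^ 2 - ⟪r, m⟫ - 2 * ⟪r, N⟫ + (‖m‖ ^ 2 / 3 + 4 * ‖N‖ ^ 2) := by
    rw [@norm_sub_sq_real, inner_add_right, inner_smul_right]
    linarith
  have h6 := mul_le_mul_of_nonneg_left h5 (by positivity : 0 ≤ β / 9)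
  rw [e2, inner_sub_right, inner_smul_right, inner_smul_right, real_inner_comm g r]
  linarith

section OneStepDrift

variable {Z : Type*} {d n : ℕ} {f : Param d → Z → ℝ} {D : Fin n → Z} {c γ t β : ℝ}
  {q : unitInterval} {ν : Measure (Param d)} [IsProbabilityMeasure ν]

lemma measurePreserving_seedLaw :
    MeasurePreserving
      (fun z : (Fin d → ℝ) × ((Fin n → Bool) × Param d) => ((z.2.1, z.1, z.2.2) : Seed d n))
      ((mixLaw d).prod ((Measure.pi fun _ : Fin n => bernoulliMeasure true false q).prod ν))
      (seedLaw n q ν) :=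
  (measurePreserving_prodAssoc _ _ _).comp
    (((Measure.measurePreserving_swap).prod (MeasurePreserving.id _)).comp
      ((measurePreserving_prodAssoc _ _ _).symm MeasurableEquiv.prodAssoc))

/-- Expected change of the potential, in terms of the clipped gradient at the newer state. -/
lemma integral_potential_step_le {F : Param d → ℝ} (hF : IsSmooth β F) (hβ : 0 < β)
    (hF0 : ∀ w, 0 ≤ F w) (hc : 0 ≤ c) (ht : 0 ≤ t) (hν : MemLp id 2 ν) (hν0 : ∫ x, x ∂ν = 0)
    (a b : Param d) :
    Integrable (fun s => potential F β (step f D c γ t s a b, a)) (seedLaw n q ν) ∧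
    ∫ s, potential F β (step f D c γ t s a b, a) ∂(seedLaw n q ν)
      ≤ F ((1 / 3 : ℝ) • ((2 : ℝ) • a + b)) + 7 * β / 108 * ‖a - b‖ ^ 2
        + β / 12 * (d * t ^ 2)
        - 2 / 3 * (γ * (q * n)) * ⟪gradient F ((1 / 3 : ℝ) • ((2 : ℝ) • a + b)), meanClip f D c a⟫
        + 4 * β / 3 * γ ^ 2 * ((n * c) ^ 2 + ∫ x, ‖x‖ ^ 2 ∂ν) := by
  set u := (1 / 3 : ℝ) • ((2 : ℝ) • a + b) with hu
  set g := gradient F u with hg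
  set ρ := (Measure.pi fun _ : Fin n => bernoulliMeasure true false q).prod ν with hρ
  set y := spreadGap t a b with hy
  set v := (2 / 3 : ℝ) • g - (β / 9) • (a - b) with hv
  set N : (Fin n → Bool) × Param d → Param d := fun x => γ • (batchGrad f D c x.1 a + x.2) with hN
  have hpot : Measurable (potential F β) := by
    have := hF.1.continuous.measurable
    unfold potential
    fun_prop
  have hpot0 : ∀ p, 0 ≤ potential F β p := fun p => add_nonneg (hF0 _) (by positivity)
  have hGm : Measurable fun x : (Fin n → Bool) × Param d => batchGrad f D c x.1 a :=
    (measurable_of_countable fun m : Fin n → Bool => batchGrad f D c m a).comp measurable_fst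
  have hGL : MemLp (fun x : (Fin n → Bool) × Param d => batchGrad f D c x.1 a) 2 ρ :=
    MemLp.of_bound hGm.aestronglyMeasurable (n * c)
      (Filter.Eventually.of_forall fun x => norm_batchGrad_le hc _ _)
  have hΔL : MemLp (fun x : (Fin n → Bool) × Param d => x.2) 2 ρ :=
    hν.comp_measurePreserving measurePreserving_snd
  have hNL : MemLp N 2 ρ := (hGL.add hΔL).const_smul γ
  have hN1 : Integrable N ρ := hNL.integrable one_le_two
  have hN2 : Integrable (fun x => ‖N x‖ ^ 2) ρ := hNL.integrable_norm_pow two_ne_zero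
  have hgN : ∫ x, ⟪g, N x⟫ ∂ρ = γ * (q * n) * ⟪g, meanClip f D c a⟫ := by
    have e1 : ∀ x, ⟪g, N x⟫ = γ * ⟪g, batchGrad f D c x.1 a⟫ + γ * ⟪g, x.2⟫ := by
      intro x; rw [hN]; simp only [inner_smul_right, inner_add_right]; ring
    have i1 : Integrable (fun x : (Fin n → Bool) × Param d => γ * ⟪g, batchGrad f D c x.1 a⟫) ρ :=
      ((hGL.integrable one_le_two).const_inner g).const_mul γ
    have i2 : Integrable (fun x : (Fin n → Bool) × Param d => γ * ⟪g, x.2⟫) ρ :=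
      ((hΔL.integrable one_le_two).const_inner g).const_mul γ
    simp_rw [e1]
    rw [integral_add i1 i2, integral_const_mul, integral_const_mul,
      integral_fun_fst (f := fun m => ⟪g, batchGrad f D c m a⟫),
      integral_fun_snd (f := fun x => ⟪g, x⟫), integral_inner_batchGrad,
      integral_inner (f := fun x => x) (hν.integrable one_le_two), hν0]
    simp
    ring
  -- The minibatch sum is bounded by `nc` regardless of the mask; this crude bound is a source of
  -- the `1/q²` in the final constant.
  have hNsq : ∫ x, ‖N x‖ ^ 2 ∂ρ ≤ 2 * γ ^ 2 * ((n * c) ^ 2 + ∫ x, ‖x‖ ^ 2 ∂ν) := by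
    have hΔ2 : Integrable (fun x : (Fin n → Bool) × Param d => ‖x.2‖ ^ 2) ρ :=
      hΔL.integrable_norm_pow two_ne_zero
    have hle : ∀ x, ‖N x‖ ^ 2 ≤ 2 * γ ^ 2 * ((n * c) ^ 2 + ‖x.2‖ ^ 2) := by
      intro x
      rw [hN]
      simp only [norm_smul, mul_pow, Real.norm_eq_abs, sq_abs]
      have h1 : ‖batchGrad f D c x.1 a + x.2‖ ^ 2 ≤ (n * c + ‖x.2‖) ^ 2 := by
        gcongr
        exact (norm_add_le _ _).trans (by gcongr; exact norm_batchGrad_le hc _ _)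
      have h2 : (n * c + ‖x.2‖) ^ 2 ≤ 2 * ((n * c) ^ 2 + ‖x.2‖ ^ 2) := by
        nlinarith [sq_nonneg (n * c - ‖x.2‖)]
      nlinarith [sq_nonneg γ, mul_le_mul_of_nonneg_left (h1.trans h2) (sq_nonneg γ)]
    refine (integral_mono hN2 (((integrable_const _).add hΔ2).const_mul _) hle).trans
      (le_of_eq ?_)
    rw [integral_const_mul, integral_add' (integrable_const _) hΔ2,
      integral_fun_snd (f := fun x : Param d => ‖x‖ ^ 2)]
    simp
  have hrm : Measurable (mixDisp y) := measurable_mixDisp y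
  have hr2 := integrable_norm_sq_mixDisp y
  have hrL : MemLp (mixDisp y) 2 (mixLaw d) :=
    (memLp_two_iff_integrable_sq_norm hrm.aestronglyMeasurable).2 hr2
  have hrN : Integrable (fun z : (Fin d → ℝ) × ((Fin n → Bool) × Param d) =>
      ⟪mixDisp y z.1, N z.2⟫) ((mixLaw d).prod ρ) := by
    refine Integrable.mono' ((hrL.integrable one_le_two).norm.mul_prod hN1.norm)
      ?_ (Filter.Eventually.of_forall fun z => by
        simpa using norm_inner_le_norm (𝕜 := ℝ) (mixDisp y z.1) (N z.2))
    have h1 : Measurable N := by rw [hN]; exact (hGm.add measurable_snd).const_smul γ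
    exact ((hrm.comp measurable_fst).inner (h1.comp measurable_snd)).aestronglyMeasurable
  have hrN0 : ∫ z, ⟪mixDisp y z.1, N z.2⟫ ∂((mixLaw d).prod ρ) = 0 := by
    rw [integral_prod _ hrN]
    simp only [integral_inner hN1]
    exact integral_inner_mixDisp y _
  set R : (Fin d → ℝ) × ((Fin n → Bool) × Param d) → ℝ := fun z =>
    F u + β / 27 * ‖a - b‖ ^ 2 + β / 3 * ‖mixDisp y z.1‖ ^ 2 + ⟪mixDisp y z.1, v⟫
      - 2 * β / 3 * ⟪mixDisp y z.1, N z.2⟫ - 2 / 3 * ⟪g, N z.2⟫ + 2 * β / 3 * ‖N z.2‖ ^ 2 with hR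
  have j0 : Integrable (fun _ : (Fin d → ℝ) × ((Fin n → Bool) × Param d) =>
    F u + β / 27 * ‖a - b‖ ^ 2) ((mixLaw d).prod ρ) := integrable_const _
  have j1 := (hr2.comp_fst ρ).const_mul (β / 3)
  have j2 := (integrable_inner_mixDisp y v).comp_fst ρ
  have j3 := hrN.const_mul (2 * β / 3)
  have j4 := ((hN1.const_inner g).comp_snd (mixLaw d)).const_mul (2 / 3 : ℝ)
  have j5 := (hN2.comp_snd (mixLaw d)).const_mul (2 * β / 3)
  have hRi : Integrable R ((mixLaw d).prod ρ) := ((((j0.add j1).add j2).sub j3).sub j4).add j5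
  have hRv : ∫ z, R z ∂((mixLaw d).prod ρ)
      = F u + β / 27 * ‖a - b‖ ^ 2 + β / 3 * (‖y‖ ^ 2 / 12)
        - 2 / 3 * (γ * (q * n) * ⟪g, meanClip f D c a⟫) + 2 * β / 3 * ∫ x, ‖N x‖ ^ 2 ∂ρ := by
    refine (integral_add' (((((j0.add j1).add j2).sub j3).sub j4)) j5).trans ?_
    rw [integral_sub' ((((j0.add j1).add j2).sub j3)) j4, integral_sub' ((j0.add j1).add j2) j3,
      integral_add' (j0.add j1) j2, integral_add' j0 j1, integral_const_mul, integral_const_mul,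
      integral_const_mul, integral_const_mul, hrN0,
      integral_fun_fst (f := fun α => ‖mixDisp y α‖ ^ 2),
      integral_fun_fst (f := fun α => ⟪mixDisp y α, v⟫),
      integral_fun_snd (f := fun x => ⟪g, N x⟫), integral_fun_snd (f := fun x => ‖N x‖ ^ 2),
      integral_norm_sq_mixDisp, integral_inner_mixDisp, hgN]
    simp
  have hstep : ∀ z : (Fin d → ℝ) × ((Fin n → Bool) × Param d),
      potential F β (step f D c γ t (z.2.1, z.1, z.2.2) a b, a) ≤ R z := by
    intro z
    rw [step_eq_add_mixDisp]
    exact potential_le_of_displacement hF hβ a b _ _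
  have hpm : Measurable fun s : Seed d n => potential F β (step f D c γ t s a b, a) :=
    hpot.comp ((measurable_step_right D γ t a b).prodMk measurable_const)
  have hpres := measurePreserving_seedLaw (d := d) (n := n) (q := q) (ν := ν)
  have hint : Integrable (fun z : (Fin d → ℝ) × ((Fin n → Bool) × Param d) =>
      potential F β (step f D c γ t (z.2.1, z.1, z.2.2) a b, a)) ((mixLaw d).prod ρ) :=
    hRi.mono' (hpm.comp hpres.measurable).aestronglyMeasurable
      (Filter.Eventually.of_forall fun z => by
        rw [Real.norm_of_nonneg (hpot0 _)]; exact hstep z)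
  refine ⟨(hpres.integrable_comp hpm.aestronglyMeasurable).1 hint, ?_⟩
  have e := integral_map (μ := (mixLaw d).prod ρ)
    (f := fun s : Seed d n => potential F β (step f D c γ t s a b, a))
    hpres.measurable.aemeasurable hpm.aestronglyMeasurable
  rw [hpres.map_eq] at e
  rw [e]
  refine (integral_mono hint hRi hstep).trans ?_
  rw [hRv]
  have h1 := mul_le_mul_of_nonneg_left (norm_sq_spreadGap_le ht a b) (by positivity : 0 ≤ β / 36)
  have h2 := mul_le_mul_of_nonneg_left hNsq (by positivity : 0 ≤ 2 * β / 3)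
  rw [← hy] at h1
  linarith

end OneStepDrift

/-! ### Utility of the iteration -/

lemma gradient_sub_const {d : ℕ} (F : Param d → ℝ) (I : ℝ) :
    gradient (fun w => F w - I) = gradient F := by
  ext1 w
  simp only [gradient, fderiv_sub_const]

lemma IsSmooth.sub_const {d : ℕ} {β : ℝ} {F : Param d → ℝ} (h : IsSmooth β F) (I : ℝ) :
    IsSmooth β fun w => F w - I := by
  refine ⟨h.1.sub_const I, fun w w' => ?_⟩
  rw [gradient_sub_const, sub_sub_sub_cancel_right]
  exact h.2 w w'

/-- The summand of the utility measure. -/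
def progress {d : ℕ} (F : Param d → ℝ) (c : ℝ) (w : Param d) : ℝ :=
  min (9 / 20 * ‖gradient F w‖ ^ 2) (c / 20 * ‖gradient F w‖)

section Utility

variable {Z : Type*} {d n : ℕ} {f : Param d → Z → ℝ} {D : Fin n → Z} {c γ β κ : ℝ}
  {q : unitInterval} {ν : Measure (Param d)} [IsProbabilityMeasure ν]

lemma progress_nonneg (F : Param d → ℝ) (hc : 0 ≤ c) (w : Param d) : 0 ≤ progress F c w :=
  le_min (by positivity) (by positivity)

lemma measurable_progress {F : Param d → ℝ} (h : IsSmooth β F) (hβ : 0 < β) :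
    Measurable (progress F c) := by
  have := (h.continuous_gradient hβ).measurable
  unfold progress
  fun_prop

lemma integral_potential_step_le_sub_progress (hn : 0 < n) (hκ : 0 < κ) (hβ : 0 < β)
    (hγ : 0 ≤ γ)
    (hf : ∀ i, Differentiable ℝ fun w => f w (D i)) (hF : IsSmooth β (risk f D))
    (ha : BddAbove (range (risk f D))) (hb : BddBelow (range (risk f D)))
    (hsub : SubExpGrad f D κ) (hc : 4 * κ * Real.log 10 ≤ c)
    (hν : MemLp id 2 ν) (hν0 : ∫ x, x ∂ν = 0) {t : ℝ} (ht : 0 ≤ t) (a b : Param d) :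
    Integrable (fun s => potential (fun w => risk f D w - ⨅ x, risk f D x) β
      (step f D c γ t s a b, a)) (seedLaw n q ν) ∧
    ∫ s, potential (fun w => risk f D w - ⨅ x, risk f D x) β
        (step f D c γ t s a b, a) ∂(seedLaw n q ν)
      ≤ potential (fun w => risk f D w - ⨅ x, risk f D x) β (a, b)
        - 4 / 3 * (γ * (q * n)) * progress (risk f D) c a
        + (β / 12 * (d * t ^ 2)
          + (2 / 3 * (γ * (q * n)) * (√(2 * β * riskGap (risk f D))
              * (2 * κ * Real.exp (-c / (2 * κ))))
            + 4 * β / 3 * γ ^ 2 * ((n * c) ^ 2 + ∫ x, ‖x‖ ^ 2 ∂ν)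
            + β / 3 * ((γ * (q * n)) * c) ^ 2)) := by
  have hlog : 0 < Real.log 10 := Real.log_pos (by norm_num)
  have hc0 : 0 < c := lt_of_lt_of_le (by positivity) hc
  have hF' := hF.sub_const (⨅ x, risk f D x)
  obtain ⟨h1, h2⟩ := integral_potential_step_le (f := f) (D := D) (γ := γ) (q := q) hF' hβ
    (fun w => sub_nonneg.2 (ciInf_le hb w)) hc0.le ht hν hν0 a b
  refine ⟨h1, h2.trans ?_⟩
  rw [gradient_sub_const]
  simp only [potential, progress]
  set u := (1 / 3 : ℝ) • ((2 : ℝ) • a + b) with hu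
  set G := gradient (risk f D) with hG
  set η := γ * (q * n) with hη
  have hη0 : 0 ≤ η := by have := q.2.1; positivity
  have k1 := le_inner_meanClip hn hκ hf hsub hc a
  have k2 : ⟪G a, meanClip f D c a⟫ - β / 3 * ‖a - b‖ * c ≤ ⟪G u, meanClip f D c a⟫ := by
    have e1 : ⟪G u, meanClip f D c a⟫
        = ⟪G a, meanClip f D c a⟫ + ⟪G u - G a, meanClip f D c a⟫ := by
      rw [inner_sub_left]; ring
    have e2 := (abs_le.1 (abs_real_inner_le_norm (G u - G a) (meanClip f D c a))).1
    have e3 : ‖u - a‖ = ‖a - b‖ / 3 := by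
      have : u - a = (-(1 / 3 : ℝ)) • (a - b) := by rw [hu]; module
      rw [this, norm_smul]; norm_num; ring
    have e4 : ‖G u - G a‖ * ‖meanClip f D c a‖ ≤ β / 3 * ‖a - b‖ * c := by
      have := hF.norm_gradient_sub_le hβ u a
      rw [e3] at this
      calc _ ≤ (β * (‖a - b‖ / 3)) * c := by
            gcongr; exact norm_meanClip_le hc0.le a
        _ = _ := by ring
    linarith
  have k3 : ‖G a‖ * (2 * κ * Real.exp (-c / (2 * κ)))
      ≤ √(2 * β * riskGap (risk f D)) * (2 * κ * Real.exp (-c / (2 * κ))) := by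
    gcongr
    exact hF.norm_gradient_le hβ ha hb a
  have k4 : 2 * min (9 / 20 * ‖G a‖ ^ 2) (c / 20 * ‖G a‖)
      - √(2 * β * riskGap (risk f D)) * (2 * κ * Real.exp (-c / (2 * κ)))
      - β / 3 * ‖a - b‖ * c ≤ ⟪G u, meanClip f D c a⟫ := by linarith
  have k5 := mul_le_mul_of_nonneg_left k4 (by positivity : 0 ≤ 2 / 3 * η)
  -- The price of evaluating the gradient at `a` instead of `u` is paid from the slack `β/9 - 7β/108
  -- = 5β/108` of the potential, as `β/27 = 4β/108`.
  have k6 : 2 / 9 * (β * (‖a - b‖ * (η * c))) ≤ β / 3 * (η * c) ^ 2 + β / 27 * ‖a - b‖ ^ 2 := by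
    nlinarith [mul_nonneg hβ.le (sq_nonneg (‖a - b‖ - 3 * (η * c)))]
  have k7 : 0 ≤ β * ‖a - b‖ ^ 2 := by positivity
  linarith

lemma states_eq_chain (τ : ℕ → ℝ) (w₀ wm : Param d) (ω : ℕ → Seed d n) (k : ℕ) :
    states f D c γ τ w₀ wm ω k
      = chain (fun k p s => (step f D c γ (τ (k + 1)) s p.1 p.2, p.1)) (w₀, wm) ω k := by
  induction k with
  | zero => rfl
  | succ k ih => simp only [states, chain, ih]

/-- Total expected progress of `T` iterations. -/
lemma sum_integral_progress_le (hn : 0 < n) (hκ : 0 < κ) (hβ : 0 < β) (hγ : 0 ≤ γ)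
    (hf : ∀ i, Differentiable ℝ fun w => f w (D i)) (hF : IsSmooth β (risk f D))
    (ha : BddAbove (range (risk f D))) (hb : BddBelow (range (risk f D)))
    (hsub : SubExpGrad f D κ) (hc : 4 * κ * Real.log 10 ≤ c)
    (hν : MemLp id 2 ν) (hν0 : ∫ x, x ∂ν = 0) {τ : ℕ → ℝ} (hτ : ∀ k, 0 ≤ τ k)
    (w₀ wm : Param d) (T : ℕ) :
    4 / 3 * (γ * (q * n)) * ∑ k ∈ Finset.range T,
        ∫ ω, progress (risk f D) c (iter f D c γ τ w₀ wm ω k) ∂(runLaw n q ν)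
      ≤ riskGap (risk f D) + β / 9 * ‖w₀ - wm‖ ^ 2
        + (β / 12 * ∑ k ∈ Finset.Icc 1 T, d * τ k ^ 2
          + T * (2 / 3 * (γ * (q * n)) * (√(2 * β * riskGap (risk f D))
              * (2 * κ * Real.exp (-c / (2 * κ))))
            + 4 * β / 3 * γ ^ 2 * ((n * c) ^ 2 + ∫ x, ‖x‖ ^ 2 ∂ν)
            + β / 3 * ((γ * (q * n)) * c) ^ 2)) := by
  have hlog : 0 < Real.log 10 := Real.log_pos (by norm_num)
  have hc0 : 0 < c := lt_of_lt_of_le (by positivity) hc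
  have hη0 : 0 ≤ γ * (q * n) := by have := q.2.1; positivity
  set P : Param d × Param d → ℝ := potential (fun w => risk f D w - ⨅ x, risk f D x) β with hP
  have hPm : Measurable P := by
    have := hF.1.continuous.measurable
    rw [hP]; unfold potential
    fun_prop
  have hP0 : ∀ p, 0 ≤ P p := fun p =>
    add_nonneg (sub_nonneg.2 (ciInf_le hb _)) (by positivity)
  have hΨ : ∀ k, Measurable fun z : (Param d × Param d) × Seed d n =>
      (step f D c γ (τ (k + 1)) z.2 z.1.1 z.1.2, z.1.1) :=
    fun k => (measurable_step f D c γ (τ (k + 1))).prodMk (by fun_prop)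
  have key := (integrable_chain_and_sum_le hΨ (w₀, wm) (seedLaw n q ν) hPm
    (M := fun p => 4 / 3 * (γ * (q * n)) * progress (risk f D) c p.1)
    (((measurable_progress hF hβ).comp measurable_fst).const_mul _) hP0
    (fun p => mul_nonneg (by positivity) (progress_nonneg _ hc0.le _))
    (fun k p => integral_potential_step_le_sub_progress hn hκ hβ hγ hf hF ha hb hsub hc hν hν0
      (hτ (k + 1)) p.1 p.2) T).2.2
  have hPT := integral_nonneg (μ := Measure.infinitePi fun _ : ℕ => seedLaw n q ν)
    (f := fun ω => P (chain (fun k p s => (step f D c γ (τ (k + 1)) s p.1 p.2, p.1))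
      (w₀, wm) ω T)) fun ω => hP0 _
  have hPx : P (w₀, wm) ≤ riskGap (risk f D) + β / 9 * ‖w₀ - wm‖ ^ 2 := by
    simp only [hP, potential, riskGap]
    gcongr
    exact le_ciSup ha _
  have hsum : ∑ k ∈ Finset.range T, (d : ℝ) * τ (k + 1) ^ 2
      = ∑ k ∈ Finset.Icc 1 T, (d : ℝ) * τ k ^ 2 := by
    rw [Finset.range_eq_Ico, Finset.sum_Ico_add' (fun k => (d : ℝ) * τ k ^ 2) 0 T 1]
    rfl
  simp only [integral_const_mul] at key
  rw [Finset.sum_add_distrib, ← Finset.mul_sum, ← Finset.mul_sum, hsum, Finset.sum_const,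
    Finset.card_range, nsmul_eq_mul] at key
  have e : ∀ k ω, iter f D c γ τ w₀ wm ω k
      = (chain (fun k p s => (step f D c γ (τ (k + 1)) s p.1 p.2, p.1)) (w₀, wm) ω k).1 :=
    fun k ω => by rw [iter, states_eq_chain]
  simp only [e, runLaw]
  linarith

end Utility

/-! ### The parameters -/

section Parameters

variable {d n : ℕ} {q β R W v c ε δ : ℝ} {τ : ℕ → ℝ}

lemma log_one_div_pos (hδ : 0 < δ) (hδ1 : δ < 1) : 0 < Real.log (1 / δ) :=
  Real.log_pos (by rw [lt_div_iff₀ hδ]; linarith)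

lemma privRate_sq (hL : 0 ≤ Real.log (1 / δ)) :
    privRate d n ε δ ^ 2 = d * Real.log (1 / δ) / (n * ε) ^ 2 := by
  rw [privRate, div_pow, Real.sq_sqrt (by positivity)]

lemma utilityBound_eq (hR : 0 ≤ R) (hβ : 0 ≤ β) (hL : 0 ≤ Real.log (1 / δ)) (T : ℕ) :
    utilityBound d n q β R W v c ε δ τ T
      = (v / 2 + 5 / 2) * (c * (√R * √(101 / 12 * β)) * privRate d n ε δ)
        + 28 * c * β * W / (12 * q) * privRate d n ε δ ^ 2
        + c * privRate d n ε δ * √(101 / 12 * β) * β / (q * √R)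
          * ((∑ k ∈ Finset.Icc 1 T, d * τ k ^ 2) / 12 + 21 * W ^ 2 / 24) := by
  have e1 : √(R * (101 / 12) * β * d * Real.log (1 / δ))
      = √R * √(101 / 12 * β) * √(d * Real.log (1 / δ)) := by
    rw [← Real.sqrt_mul hR, ← Real.sqrt_mul (by positivity)]
    congr 1; ring
  have e2 : √(101 / 12 * β) = √(101 / 12) * √β := Real.sqrt_mul (by norm_num) _
  rw [utilityBound, privRate_sq hL, e1, e2, privRate]
  congr 1
  · congr 1
    · ring
    · simp only [div_eq_mul_inv, mul_inv]; ring
  · congr 1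
    simp only [div_eq_mul_inv, mul_inv]; ring

lemma stepSize_eq (hR : 0 ≤ R) :
    stepSize d n q β R c ε δ = √R * privRate d n ε δ * q / (c * √(101 / 12 * β)) := by
  rw [stepSize, privRate, Real.sqrt_mul hR]
  simp only [div_eq_mul_inv, mul_inv, inv_inv]; ring

lemma numIter_mul_sq_le (hL : 0 < Real.log (1 / δ)) (hρ : privRate d n ε δ ≤ 1) (hn : 0 < n)
    (hε : 0 < ε) : numIter d n ε δ * privRate d n ε δ ^ 2 ≤ 2 := by
  rcases Nat.eq_zero_or_pos d with rfl | hd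
  · simp [numIter]
  have hd' : (0 : ℝ) < d := by positivity
  have hn' : (0 : ℝ) < n := by positivity
  have h0 : 0 ≤ privRate d n ε δ := by unfold privRate; positivity
  have h1 : privRate d n ε δ ^ 2 ≤ 1 := pow_le_one₀ h0 hρ
  have h2 := (Nat.ceil_lt_add_one
    (by positivity : 0 ≤ (n * ε) ^ 2 / (d * Real.log (1 / δ)))).le
  rw [privRate_sq hL.le] at h1 ⊢
  have h3 : (n * ε) ^ 2 / (d * Real.log (1 / δ)) * (d * Real.log (1 / δ) / (n * ε) ^ 2) = 1 := by
    field_simp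
  calc _ ≤ ((n * ε) ^ 2 / (d * Real.log (1 / δ)) + 1) * (d * Real.log (1 / δ) / (n * ε) ^ 2) := by
        unfold numIter; gcongr
    _ ≤ 2 := by rw [add_mul, h3]; linarith

lemma one_le_numIter_mul_sq (hL : 0 < Real.log (1 / δ)) (hd : 0 < d) (hn : 0 < n)
    (hε : 0 < ε) : 1 ≤ numIter d n ε δ * privRate d n ε δ ^ 2 := by
  have hd' : (0 : ℝ) < d := by positivity
  have hn' : (0 : ℝ) < n := by positivity
  have h2 := Nat.le_ceil ((n * ε) ^ 2 / (d * Real.log (1 / δ)))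
  rw [privRate_sq hL.le]
  have h3 : (n * ε) ^ 2 / (d * Real.log (1 / δ)) * (d * Real.log (1 / δ) / (n * ε) ^ 2) = 1 := by
    field_simp
  exact h3.symm.le.trans (mul_le_mul_of_nonneg_right h2 (by positivity))

lemma one_le_log_ten : 1 ≤ Real.log 10 := by
  rw [Real.le_log_iff_exp_le (by norm_num)]
  linarith [Real.exp_one_lt_d9]

/-- With thresholds of the order of the step size, the utility bound is of order `c` times the
privacy rate. -/
theorem exists_utilityBound_le {κ : ℝ} (hκ : 1 < κ) (d : ℕ) (q β R W v K : ℝ) (hq : 0 < q)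
    (hβ : 0 < β) (hR : 0 < R) (hW : 0 ≤ W) (hv : 0 ≤ v) :
    ∃ C : ℝ, 0 < C ∧ ∀ (n : ℕ) (c ε δ : ℝ) (τ : ℕ → ℝ),
      0 < n → 0 < ε → 0 < δ → δ < 1 → privRate d n ε δ ≤ 1 → 4 * κ * Real.log 10 ≤ c →
      (∀ k ∈ Finset.Icc 1 (numIter d n ε δ),
        0 ≤ τ k ∧ τ k ≤ K * stepSize d n q β R c ε δ) →
      utilityBound d n q β R W v c ε δ τ (numIter d n ε δ) ≤ C * (c * privRate d n ε δ) := by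
  set B := √(101 / 12 * β) with hB
  have hB0 : 0 < B := by positivity
  have hr0 : 0 < √R := by positivity
  refine ⟨(v / 2 + 5 / 2) * (√R * B) + 28 * β * W / (12 * q)
    + B * β / (q * √R) * ((2 * d * (K * (√R * q / B)) ^ 2) / 12 + 21 * W ^ 2 / 24),
    by positivity, fun n c ε δ τ hn hε hδ hδ1 hρ hc hτ => ?_⟩
  have hL := log_one_div_pos hδ hδ1
  have hc1 : 1 ≤ c := by nlinarith [one_le_log_ten]
  have hc0 : 0 < c := by linarith
  set ρ := privRate d n ε δ with hρdef
  have hρ0 : 0 ≤ ρ := by rw [hρdef]; unfold privRate; positivity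
  set T := numIter d n ε δ with hT
  have hTρ : T * ρ ^ 2 ≤ 2 := numIter_mul_sq_le hL hρ hn hε
  have hsum : ∑ k ∈ Finset.Icc 1 T, (d : ℝ) * τ k ^ 2 ≤ 2 * d * (K * (√R * q / B)) ^ 2 := by
    have hk : ∀ k ∈ Finset.Icc 1 T, (d : ℝ) * τ k ^ 2 ≤ d * (ρ ^ 2 * (K * (√R * q / B)) ^ 2) := by
      intro k hk
      obtain ⟨h0, h1⟩ := hτ k hk
      rw [stepSize_eq hR.le, ← hB] at h1
      have h2 : τ k ≤ (K * (√R * q / B) * ρ) / c := by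
        refine h1.trans (le_of_eq ?_)
        field_simp
        rfl
      -- The sign follows from `0 ≤ τ k`; it allows `1/c ≤ 1` to be dropped, which keeps the
      -- constant free of `c`.
      have h3 : 0 ≤ K * (√R * q / B) * ρ := by
        by_contra hneg
        have := div_neg_of_neg_of_pos (not_le.1 hneg) hc0
        linarith
      have h4 : τ k ≤ K * (√R * q / B) * ρ := h2.trans (div_le_self h3 hc1)
      calc (d : ℝ) * τ k ^ 2 ≤ d * (K * (√R * q / B) * ρ) ^ 2 := by gcongr
        _ = _ := by ring
    refine (Finset.sum_le_sum hk).trans ?_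
    rw [Finset.sum_const, Nat.card_Icc, nsmul_eq_mul, Nat.add_sub_cancel]
    have := mul_le_mul_of_nonneg_right hTρ
      (by positivity : 0 ≤ (d : ℝ) * (K * (√R * q / B)) ^ 2)
    linarith
  rw [utilityBound_eq hR.le hβ.le hL.le, ← hB, ← hρdef]
  have t2 : 28 * c * β * W / (12 * q) * ρ ^ 2 ≤ 28 * c * β * W / (12 * q) * ρ := by
    gcongr
    nlinarith
  have t3 : c * ρ * B * β / (q * √R)
      * ((∑ k ∈ Finset.Icc 1 T, (d : ℝ) * τ k ^ 2) / 12 + 21 * W ^ 2 / 24)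
      ≤ c * ρ * B * β / (q * √R)
        * ((2 * d * (K * (√R * q / B)) ^ 2) / 12 + 21 * W ^ 2 / 24) := by
    gcongr
  refine (add_le_add (add_le_add le_rfl t2) t3).trans (le_of_eq ?_)
  ring

end Parameters

/-! ### The utility bound -/

section UtilityBound

lemma utilityBound_nonneg {d n : ℕ} {q β R W v c ε δ : ℝ} {τ : ℕ → ℝ} (hq : 0 ≤ q) (hβ : 0 ≤ β)
    (hW : 0 ≤ W) (hv : 0 ≤ v) (hc : 0 ≤ c) (hε : 0 ≤ ε) (hL : 0 ≤ Real.log (1 / δ)) (T : ℕ) :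
    0 ≤ utilityBound d n q β R W v c ε δ τ T := by
  unfold utilityBound
  positivity

set_option maxHeartbeats 1000000 in
/-- The comparison of the expected progress with the utility bound, in terms of
`ρ = privRate`, `B = √(101β/12)`, `r = √R` and the step size `η`. -/
lemma progress_bound_le {q β r W V c κ ρ B η T X s bias noise sτ : ℝ} (hq : 0 < q) (hq1 : q ≤ 1)
    (hβ : 0 < β) (hr : 0 < r) (hc : 0 < c) (hκc : κ ≤ c) (hρ : 0 < ρ) (hV : 0 ≤ V)
    (hB : 0 < B) (hB2 : B ^ 2 = 101 / 12 * β) (hη : η = r * ρ * q / (c * B))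
    (hT1 : 1 ≤ T * ρ ^ 2) (hT2 : T * ρ ^ 2 ≤ 2) (hT : 0 < T) (hsτ : 0 ≤ sτ)
    (hs : s ≤ B * r) (hs0 : 0 ≤ s) (hbias : bias ≤ 2 * κ * ρ)
    (hnoise : noise ≤ V * (η * c / q) ^ 2 * (T * ρ ^ 2))
    (hX : 4 / 3 * η * X ≤ r ^ 2 + β / 9 * W ^ 2 + (β / 12 * sτ + T * (2 / 3 * η * (s * bias)
      + 4 * β / 3 * ((η * c / q) ^ 2 + noise) + β / 3 * (η * c) ^ 2))) :
    X / T ≤ ((2 * (3 / (4 * q) + (1 + 2 * V) / q ^ 2)) / 2 + 5 / 2) * (c * (r * B) * ρ)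
      + c * ρ * B * β / (q * r) * (sτ / 12 + 21 * W ^ 2 / 24) := by
  have hη0 : 0 < η := by rw [hη]; positivity
  have hηc : η * c * B = r * ρ * q := by rw [hη]; field_simp
  have hinvη : ρ / η = c * B / (r * q) := by rw [hη]; field_simp
  have a1 : s * bias ≤ B * r * (2 * c * ρ) := by
    have : bias ≤ 2 * c * ρ := hbias.trans (by gcongr)
    exact (mul_le_mul_of_nonneg_left this hs0).trans (by gcongr)
  have a2 : noise ≤ 2 * V * (η * c / q) ^ 2 := by
    refine hnoise.trans ?_
    have := mul_le_mul_of_nonneg_left hT2 (by positivity : 0 ≤ V * (η * c / q) ^ 2)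
    linarith
  -- Only `β ≤ B²` is needed from the factor `101/12`. It shows that each second-order term is of
  -- size `ηY`, with a factor depending on `q` and `V`.
  have a3 : β * (η * c) ≤ r * B * ρ := by
    have h1 : β ≤ B ^ 2 := by rw [hB2]; linarith
    calc β * (η * c) ≤ B ^ 2 * (η * c) := by gcongr
      _ = (r * B * ρ) * q := by rw [show B ^ 2 * (η * c) = B * (η * c * B) by ring, hηc]; ring
      _ ≤ (r * B * ρ) * 1 := by gcongr
      _ = _ := mul_one _
  set Y := c * (r * B) * ρ with hY
  have hY0 : 0 ≤ Y := by positivity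
  have a4 : β * (η * c) ^ 2 ≤ η * Y := by
    have := mul_le_mul_of_nonneg_left a3 (by positivity : 0 ≤ η * c)
    calc β * (η * c) ^ 2 = η * c * (β * (η * c)) := by ring
      _ ≤ η * c * (r * B * ρ) := this
      _ = _ := by rw [hY]; ring
  have a5 : 2 / 3 * η * (s * bias) + 4 * β / 3 * ((η * c / q) ^ 2 + noise) + β / 3 * (η * c) ^ 2
      ≤ η * Y * (4 / 3 + 4 / 3 * (1 + 2 * V) / q ^ 2 + 1 / 3) := by
    have b1 : 2 / 3 * η * (s * bias) ≤ 2 / 3 * η * (B * r * (2 * c * ρ)) := by gcongr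
    have b2 : 4 * β / 3 * ((η * c / q) ^ 2 + noise)
        ≤ 4 / 3 * (1 + 2 * V) / q ^ 2 * (η * Y) := by
      calc _ ≤ 4 * β / 3 * ((η * c / q) ^ 2 + 2 * V * (η * c / q) ^ 2) := by gcongr
        _ = 4 / 3 * (1 + 2 * V) / q ^ 2 * (β * (η * c) ^ 2) := by field_simp
        _ ≤ _ := by gcongr
    have b3 : 2 / 3 * η * (B * r * (2 * c * ρ)) = 4 / 3 * (η * Y) := by rw [hY]; ring
    linarith
  have a6 : X / T ≤ 3 / (4 * (η * T)) * (r ^ 2 + β / 9 * W ^ 2 + β / 12 * sτ)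
      + 3 / 4 * (Y * (4 / 3 + 4 / 3 * (1 + 2 * V) / q ^ 2 + 1 / 3)) := by
    have h1 : 4 / 3 * η * X ≤ r ^ 2 + β / 9 * W ^ 2 + β / 12 * sτ
        + T * (η * Y * (4 / 3 + 4 / 3 * (1 + 2 * V) / q ^ 2 + 1 / 3)) := by
      have := mul_le_mul_of_nonneg_left a5 hT.le
      linarith
    have h2 : X ≤ 3 / (4 * η) * (r ^ 2 + β / 9 * W ^ 2 + β / 12 * sτ
        + T * (η * Y * (4 / 3 + 4 / 3 * (1 + 2 * V) / q ^ 2 + 1 / 3))) := by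
      have := mul_le_mul_of_nonneg_left h1 (by positivity : 0 ≤ 3 / (4 * η))
      rwa [show 3 / (4 * η) * (4 / 3 * η * X) = X by field_simp] at this
    rw [div_le_iff₀ hT]
    refine h2.trans (le_of_eq ?_)
    field_simp
  have a7 : 3 / (4 * (η * T)) ≤ 3 / 4 * (c * ρ * B / (r * q)) := by
    have h1 : 1 / T ≤ ρ ^ 2 := by rw [div_le_iff₀ hT]; linarith
    calc 3 / (4 * (η * T)) = 3 / (4 * η) * (1 / T) := by field_simp
      _ ≤ 3 / (4 * η) * ρ ^ 2 := by gcongr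
      _ = 3 / 4 * ρ * (ρ / η) := by field_simp
      _ = _ := by rw [hinvη]; ring
  have a8 := mul_le_mul_of_nonneg_right a7
    (by positivity : 0 ≤ r ^ 2 + β / 9 * W ^ 2 + β / 12 * sτ)
  have a9 : 3 / 4 * (c * ρ * B / (r * q)) * (r ^ 2 + β / 9 * W ^ 2 + β / 12 * sτ)
      = 3 / (4 * q) * Y + c * ρ * B * β / (q * r) * (sτ / 16 + W ^ 2 / 12) := by
    rw [hY]; field_simp; ring
  have a10 : c * ρ * B * β / (q * r) * (sτ / 16 + W ^ 2 / 12)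
      ≤ c * ρ * B * β / (q * r) * (sτ / 12 + 21 * W ^ 2 / 24) := by
    refine mul_le_mul_of_nonneg_left ?_ (by positivity)
    linarith [sq_nonneg W]
  have e : ((2 * (3 / (4 * q) + (1 + 2 * V) / q ^ 2)) / 2 + 5 / 2) * Y
      = 3 / (4 * q) * Y + (1 + 2 * V) / q ^ 2 * Y + 5 / 2 * Y := by ring
  have e2 : 3 / 4 * (Y * (4 / 3 + 4 / 3 * (1 + 2 * V) / q ^ 2 + 1 / 3))
      = (1 + 2 * V) / q ^ 2 * Y + 5 / 4 * Y := by ring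
  rw [e]
  linarith

variable {Z : Type*} {d n : ℕ} {f : Param d → Z → ℝ} {D : Fin n → Z} {c β κ ε δ V : ℝ}
  {q : unitInterval} {ν : Measure (Param d)} [IsProbabilityMeasure ν] {τ : ℕ → ℝ}

theorem integrable_and_integral_avg_le (hκ : 1 < κ) (hq : 0 < (q : ℝ)) (hV : 0 ≤ V)
    (w₀ wm : Param d) (hn : 0 < n) (hβ : 0 < β) (hε : 0 < ε) (hδ : 0 < δ) (hδ1 : δ < 1)
    (hτ : ∀ k, 0 ≤ τ k) (hf : ∀ i, Differentiable ℝ fun w => f w (D i))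
    (hF : IsSmooth β (risk f D)) (ha : BddAbove (range (risk f D)))
    (hb : BddBelow (range (risk f D))) (hsub : SubExpGrad f D κ)
    (hc : 4 * κ * Real.log 10 ≤ c) (hc2 : -(2 * κ) * Real.log (privRate d n ε δ) ≤ c)
    (hν : NoiseLevel ν V c ε δ (numIter d n ε δ)) :
    let γ := stepSize d n q β (riskGap (risk f D)) c ε δ / (n * q)
    let avg : (ℕ → Seed d n) → ℝ := fun ω =>
      (∑ k ∈ Finset.range (numIter d n ε δ), progress (risk f D) c (iter f D c γ τ w₀ wm ω k))
        / (numIter d n ε δ : ℝ)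
    Integrable avg (runLaw n q ν) ∧
    ∫ ω, avg ω ∂(runLaw n q ν) ≤ utilityBound d n q β (riskGap (risk f D)) ‖w₀ - wm‖
      (2 * (3 / (4 * q) + (1 + 2 * V) / q ^ 2)) c ε δ τ (numIter d n ε δ) := by
  intro γ avg
  have hL := log_one_div_pos hδ hδ1
  have hκ0 : 0 < κ := by linarith
  have hκc : κ ≤ c := by nlinarith [one_le_log_ten]
  have hc0 : 0 < c := by linarith
  have hn' : (0 : ℝ) < n := by positivity
  set R := riskGap (risk f D) with hR
  set T := numIter d n ε δ with hT
  set ρ := privRate d n ε δ with hρ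
  set B := √(101 / 12 * β) with hB
  have hB0 : 0 < B := by positivity
  have hR0 : 0 ≤ R := by simpa using sub_le_riskGap ha hb w₀ w₀
  have hρ0 : 0 ≤ ρ := by rw [hρ]; unfold privRate; positivity
  have hprob : IsProbabilityMeasure (runLaw n q ν) := by unfold runLaw; infer_instance
  have hs : √(2 * β * R) ≤ B * √R := by
    rw [hB, ← Real.sqrt_mul (by positivity)]
    refine Real.sqrt_le_sqrt ?_
    nlinarith [mul_nonneg hβ.le hR0]
  have hprog : ∀ w, progress (risk f D) c w ≤ c / 20 * (B * √R) := by
    intro w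
    refine (min_le_right _ _).trans ?_
    gcongr
    exact (hF.norm_gradient_le hβ ha hb w).trans hs
  have hpm : ∀ k, Measurable fun ω => progress (risk f D) c (iter f D c γ τ w₀ wm ω k) :=
    fun k => (measurable_progress hF hβ).comp (measurable_states f D c γ τ w₀ wm k).fst
  have hpi : ∀ k, Integrable (fun ω => progress (risk f D) c (iter f D c γ τ w₀ wm ω k))
      (runLaw n q ν) := fun k =>
    Integrable.of_bound (hpm k).aestronglyMeasurable (c / 20 * (B * √R))
      (Filter.Eventually.of_forall fun ω => by
        rw [Real.norm_of_nonneg (progress_nonneg _ hc0.le _)]; exact hprog _)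
  have hint : Integrable avg (runLaw n q ν) :=
    (integrable_finsetSum _ fun k _ => hpi k).div_const _
  have havg : ∫ ω, avg ω ∂(runLaw n q ν) = (∑ k ∈ Finset.range T,
      ∫ ω, progress (risk f D) c (iter f D c γ τ w₀ wm ω k) ∂(runLaw n q ν)) / T := by
    rw [integral_div, integral_finsetSum _ fun k _ => hpi k]
  refine ⟨hint, ?_⟩
  have hv0 : 0 ≤ 2 * (3 / (4 * (q : ℝ)) + (1 + 2 * V) / q ^ 2) := by positivity
  -- The bound from the uniform gradient estimate alone. It settles `R = 0`, where both sides
  -- collapse to `0` at most, and `ρ ≥ 1`, where `Tρ²` is not bounded by `2`.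
  have htriv : ∫ ω, avg ω ∂(runLaw n q ν) ≤ c / 20 * (B * √R) := by
    have hb : ∀ ω, avg ω ≤ c / 20 * (B * √R) := by
      intro ω
      refine div_le_of_le_mul₀ (Nat.cast_nonneg _) (by positivity) ?_
      refine (Finset.sum_le_sum fun k _ => hprog _).trans (le_of_eq ?_)
      simp [mul_comm]
    refine (integral_mono hint (integrable_const _) hb).trans (le_of_eq ?_)
    simp
  have hU0 := utilityBound_nonneg (d := d) (n := n) (R := R) (τ := τ) hq.le hβ.le
    (norm_nonneg (w₀ - wm)) hv0 hc0.le hε.le hL.le T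
  rcases Nat.eq_zero_or_pos d with hd | hd
  · have hT0 : T = 0 := by subst hd; simp [hT, numIter]
    rw [havg]
    rw [hT0] at hU0 ⊢
    simpa using hU0
  rcases hR0.eq_or_lt with hR1 | hR1
  · rw [← hR1] at htriv ⊢
    rw [← hR1] at hU0
    exact htriv.trans (by simpa using hU0)
  have hρpos : 0 < ρ := by rw [hρ]; unfold privRate; positivity
  have hsum0 : 0 ≤ ∑ k ∈ Finset.Icc 1 T, (d : ℝ) * τ k ^ 2 :=
    Finset.sum_nonneg fun k _ => by positivity
  rw [utilityBound_eq hR0 hβ.le hL.le, ← hB, ← hρ]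
  have hmid : 0 ≤ 28 * c * β * ‖w₀ - wm‖ / (12 * q) * ρ ^ 2 := by positivity
  have hlast : 0 ≤ c * ρ * B * β / (q * √R)
      * ((∑ k ∈ Finset.Icc 1 T, (d : ℝ) * τ k ^ 2) / 12 + 21 * ‖w₀ - wm‖ ^ 2 / 24) := by positivity
  rcases le_or_gt 1 ρ with hρ1 | hρ1
  · have h1 : c / 20 * (B * √R) ≤ ((2 * (3 / (4 * (q : ℝ)) + (1 + 2 * V) / q ^ 2)) / 2 + 5 / 2)
        * (c * (√R * B) * ρ) := by
      have h2 : c * (√R * B) * 1 ≤ c * (√R * B) * ρ := by gcongr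
      have h3 : 5 / 2 * (c * (√R * B) * ρ)
          ≤ ((2 * (3 / (4 * (q : ℝ)) + (1 + 2 * V) / q ^ 2)) / 2 + 5 / 2)
            * (c * (√R * B) * ρ) := by
        gcongr; linarith
      have h4 : 0 ≤ c * (√R * B) := by positivity
      linarith
    linarith
  · have hT1 := one_le_numIter_mul_sq hL hd hn hε
    have hT2 := numIter_mul_sq_le hL hρ1.le hn hε
    rw [← hT, ← hρ] at hT1 hT2
    have hTpos : (0 : ℝ) < T := by
      by_contra h
      have : (T : ℝ) * ρ ^ 2 ≤ 0 := mul_nonpos_of_nonpos_of_nonneg (not_lt.1 h) (by positivity)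
      linarith
    set η := stepSize d n q β R c ε δ with hη
    have hηeq : η = √R * ρ * q / (c * B) := stepSize_eq hR0
    have hη0 : 0 < η := by rw [hηeq]; positivity
    have hγ : γ = η / (n * q) := rfl
    have hγη : γ * (q * n) = η := by rw [hγ]; field_simp
    -- This is where `c ≥ -2κ log ρ` enters: it is equivalent to `exp(-c/(2κ)) ≤ ρ`.
    have hbias : 2 * κ * Real.exp (-c / (2 * κ)) ≤ 2 * κ * ρ := by
      gcongr
      rw [← Real.le_log_iff_exp_le hρpos, div_le_iff₀ (by positivity)]
      linarith
    have hγn : γ ^ 2 * (n * c) ^ 2 = (η * c / q) ^ 2 := by rw [hγ]; field_simp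
    have hnoise : γ ^ 2 * ∫ x, ‖x‖ ^ 2 ∂ν ≤ V * (η * c / q) ^ 2 * (T * ρ ^ 2) := by
      refine (mul_le_mul_of_nonneg_left hν.2.2 (sq_nonneg γ)).trans (le_of_eq ?_)
      rw [hρ, privRate_sq hL.le]
      rw [hγ]
      field_simp
    have key := sum_integral_progress_le (γ := γ) (q := q) (ν := ν) hn hκ0 hβ (by positivity)
      hf hF ha hb hsub hc hν.1 hν.2.1 hτ w₀ wm T
    rw [hγη] at key
    have hfin := progress_bound_le (q := (q : ℝ)) (β := β) (r := √R) (W := ‖w₀ - wm‖) (V := V)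
      (c := c) (κ := κ) (ρ := ρ) (B := B) (η := η) (T := T) hq q.2.2 hβ (by positivity) hc0
      hκc hρpos hV hB0 (Real.sq_sqrt (by positivity)) hηeq hT1 hT2 hTpos hsum0 hs
      (Real.sqrt_nonneg _) hbias hnoise (X := ∑ k ∈ Finset.range T,
        ∫ ω, progress (risk f D) c (iter f D c γ τ w₀ wm ω k) ∂(runLaw n q ν)) (by
        rw [Real.sq_sqrt hR0, ← hγn]
        refine key.trans (le_of_eq ?_)
        ring)
    rw [havg]
    linarith

end UtilityBound

end ModelMix

end

/-! ### Choice of the constants -/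

theorem mainTheorem2 (κ : ℝ) (hκ : 1 < κ) :
    ∃ ψ : ℝ, 0 < ψ ∧
    -- utility, for every noise mechanism of level `V`
    (∀ (q : unitInterval) (V : ℝ), 0 < (q : ℝ) → 0 ≤ V →
      ∃ v : ℝ, 0 ≤ v ∧
      ∀ (Z : Type u) (d n : ℕ) (f : Param d → Z → ℝ) (D : Fin n → Z) (β c ε δ : ℝ)
        (τ : ℕ → ℝ) (w₀ wm : Param d) (ν : Measure (Param d)) [IsProbabilityMeasure ν],
        0 < n → 0 < β → 0 < ε → 0 < δ → δ < 1 → (∀ k, 0 ≤ τ k) →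
        (∀ i, Differentiable ℝ fun w => f w (D i)) →
        IsSmooth β (risk f D) →
        BddAbove (Set.range (risk f D)) → BddBelow (Set.range (risk f D)) →
        SubExpGrad f D κ →
        max (4 * κ * Real.log 10) (-ψ * κ * Real.log κ * Real.log (privRate d n ε δ)) ≤ c →
        NoiseLevel ν V c ε δ (numIter d n ε δ) →
        let R := riskGap (risk f D)
        let T := numIter d n ε δ
        let γ := stepSize d n q β R c ε δ / (n * q)
        let avg : (ℕ → Seed d n) → ℝ := fun ω =>
          (∑ k ∈ Finset.range T,
            min (9 / 20 * ‖gradient (risk f D) (iter f D c γ τ w₀ wm ω k)‖ ^ 2)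
              (c / 20 * ‖gradient (risk f D) (iter f D c γ τ w₀ wm ω k)‖)) / T
        Integrable avg (runLaw n q ν) ∧
        ∫ ω, avg ω ∂(runLaw n q ν) ≤ utilityBound d n q β R ‖w₀ - wm‖ v c ε δ τ T) ∧
    -- privacy, for Gaussian noise of such a level
    (∀ A : ℝ, 0 < A →
      ∃ V : ℝ, 0 < V ∧
      ∀ (Z : Type u) (d : ℕ) (f : Param d → Z → ℝ) (q : unitInterval) (c γ ε δ : ℝ)
        (τ : ℕ → ℝ) (w₀ wm : Param d) (T : ℕ),
        0 < c → 0 < ε → 0 < δ → δ < 1 → ε ≤ A * Real.log (1 / δ) →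
        NoiseLevel (gaussNoise d V c ε δ T) V c ε δ T ∧
        IsDP ε δ fun (n : ℕ) (D : Fin n → Z) =>
          trajLaw f D c γ τ w₀ wm q (gaussNoise d V c ε δ T) T) ∧
    -- order of the bound when `τ_k = O(η)`
    (∀ (d : ℕ) (q β R W v K : ℝ), 0 < q → q ≤ 1 → 0 < β → 0 < R → 0 ≤ W → 0 ≤ v → 0 ≤ K →
      ∃ C : ℝ, 0 < C ∧
      ∀ (n : ℕ) (c ε δ : ℝ) (τ : ℕ → ℝ),
        0 < n → 0 < ε → 0 < δ → δ < 1 → privRate d n ε δ ≤ 1 → 4 * κ * Real.log 10 ≤ c →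
        (∀ k ∈ Finset.Icc 1 (numIter d n ε δ),
          0 ≤ τ k ∧ τ k ≤ K * stepSize d n q β R c ε δ) →
        utilityBound d n q β R W v c ε δ τ (numIter d n ε δ) ≤ C * (c * privRate d n ε δ)) := by
  have hlog : 0 < Real.log κ := Real.log_pos hκ
  -- With this `ψ` the product `ψ κ log κ` is exactly `2κ`, the scale at which the clipping bias
  -- falls to `2κρ`.
  refine ⟨2 / Real.log κ, by positivity, ?_, ?_, ?_⟩
  · intro q V hq hV
    -- In `v/2`, the term `3/(4q)` stems from the initial risk gap and `(1 + 2V)/q²` from the second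
    -- moments of the minibatch sum and the noise.
    refine ⟨2 * (3 / (4 * q) + (1 + 2 * V) / q ^ 2), by positivity, ?_⟩
    intro Z d n f D β c ε δ τ w₀ wm ν _ hn hβ hε hδ hδ1 hτ hf hF ha hb hsub hc hν
    have hc2 : -(2 * κ) * Real.log (privRate d n ε δ) ≤ c := by
      refine le_trans (le_of_eq ?_) ((le_max_right _ _).trans hc)
      field_simp
    exact integrable_and_integral_avg_le hκ hq hV w₀ wm hn hβ hε hδ hδ1 hτ hf hF ha hb hsub
      ((le_max_left _ _).trans hc) hc2 hν
  · intro A hA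
    refine ⟨A + 2, by positivity, ?_⟩
    intro Z d f q c γ ε δ τ w₀ wm T hc hε hδ hδ1 hεA
    have hL := log_one_div_pos hδ hδ1
    exact ⟨noiseLevel_gaussNoise d (by positivity),
      isDP_trajLaw f q τ w₀ wm T hA hc hε hδ hδ1 hεA⟩
  · intro d q β R W v K hq _ hβ hR hW hv _
    exact exists_utilityBound_le hκ d q β R W v K hq hβ hR hW hv
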